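/- **Theorem (CutOrBound).** Consider unweighted multigraphs $G$ without loops on $n$ vertices, with all degrees $d_j\ge 1$, and let $m=\sum_j d_j$. The lazy random walk stays put with probability $1/2$ and otherwise moves along a uniformly random incident edge; $p^{l}_j$ is the probability that the walk started at $i$ is at $j$ after $l$ steps. For a vertex set $S\neq\emptyset,V$ put $\mathrm{vol}(S)=\sum_{j\in S}d_j$ and define its conductance as $$\phi_S=\frac{|E(S,\bar S)|}{\min\{2\,\mathrm{vol}(S),\,2\,\mathrm{vol}(\bar S)\}}$$ (every vertex $j$ is thought of as carrying a self-loop of weight $d_j$, which makes the walk lazy). There is a randomized algorithm CutOrBound, which on a word RAM has access to the adjacency lists of $G$ (a degree query, a query for the $k$-th entry of an adjacency list, the choice of a uniformly random number below a given word, an operation on words of $O(\log m)$ bits, and a comparison $x<\phi y$ of words $x,y$ cost one time unit each) and receives $n$, $m$, a start vertex $i$, the walk length $\ell$, the number $\lceil 1/\alpha\rceil$ and the threshold $\phi$, such that the following holds. Let $\zeta>0$, $\tau<1$ and $K\in\mathbb N$ be constants with $\zeta\tau<1/8$, and let $\phi\in[0,1/2]$ satisfy $$-\log\Big(\tfrac12\big(\sqrt{1-2\phi}+\sqrt{1+2\phi}\big)\Big)=\zeta\tau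 .$$ For every such $G$ with $m\le n^{K}$ and every start vertex $i$, with $\ell=\lceil \ln(m)/\zeta\rceil$ and $\alpha=m^{-\tau}$, the algorithm runs in time $O(\log^4(n)/\alpha)$, and with probability $1-o(1)$ as $n\to\infty$ it either outputs a set $S\ne\emptyset,V$ of conductance $\phi_S<\phi$, or declares, correctly, that $$\max_j \frac{p^{\ell}_j}{2d_j}\le 256\,\alpha .$$ The constant in $O(\cdot)$, the constant in the word length and the $o(1)$ term depend only on $\zeta,\tau,\phi,K$, and not on $G$ or $i$. -/

import Mathlib

/-- A finite unweighted multigraph on `Fin n` without loops, given by its adjacency lists: `nbrs u`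
lists the other endpoints of the edges at `u`, in any order, and a neighbour `v` occurs in it as
often as there are parallel edges between `u` and `v`. -/
structure Multigraph (n : ℕ) where
  nbrs : Fin n → List (Fin n)
  symm : ∀ u v, (nbrs u).count v = (nbrs v).count u
  loopless : ∀ u, u ∉ nbrs u

namespace Multigraph

variable {n : ℕ} (G : Multigraph n)

/-- The number of parallel edges between `u` and `v` (the weight of the pair). -/
def mult (u v : Fin n) : ℕ := (G.nbrs u).count v

/-- The degree `d_u`, counted with multiplicity. -/
def deg (u : Fin n) : ℕ := (G.nbrs u).length

/-- The sum `m` of all degrees. -/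
def totalDeg : ℕ := ∑ u, G.deg u

/-- Transition matrix of the lazy random walk: stay with probability `1/2`, otherwise move along
a uniformly random incident edge. -/
noncomputable def lazyMatrix : Matrix (Fin n) (Fin n) ℝ :=
  fun u v => (if u = v then 1 / 2 else 0) + (G.mult u v : ℝ) / (2 * G.deg u)

/-- The probability that the lazy random walk from `i` is at `j` after `l` steps. -/
noncomputable def walkProb (i : Fin n) (l : ℕ) (j : Fin n) : ℝ := (G.lazyMatrix ^ l) i j

/-- The number of edges between `S` and its complement. -/
def cutSize (S : Finset (Fin n)) : ℕ := ∑ u ∈ S, ∑ v ∈ Sᶜ, G.mult u v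

/-- The weight of `S`: twice the sum of the degrees, since every vertex `u` carries in addition a
self-loop of weight `d_u`, which makes the walk lazy. -/
def weight (S : Finset (Fin n)) : ℕ := ∑ u ∈ S, 2 * G.deg u

/-- Conductance of `S` (for the graph with the self-loops). -/
noncomputable def conductance (S : Finset (Fin n)) : ℝ :=
  (G.cutSize S : ℝ) / (min (G.weight S) (G.weight Sᶜ) : ℕ)

end Multigraph

/-! ### A randomized word RAM with access to the adjacency lists of a graph

Memory consists of registers and zero-initialised arrays, all holding words (numbers below a
modulus `M`). Programs are structured: assignments, array writes, uniform random numbers,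
sequencing, branching and bounded loops. Every elementary operation costs one time unit. -/

namespace RAM

/-- Expressions over words. Arithmetic is modulo the word modulus, `sub` is truncated at zero and
division by zero gives zero. `deg e` is the degree of vertex `e`; `nbr e f` is the entry with
index `f` (counted from zero) of the adjacency list of vertex `e`. -/
inductive Expr where
  | lit (k : ℕ)
  | reg (r : ℕ)
  | read (a : ℕ) (e : Expr)
  | add (e f : Expr)
  | sub (e f : Expr)
  | mul (e f : Expr)
  | div (e f : Expr)
  | deg (e : Expr)
  | nbr (e f : Expr)

/-- Tests. `ltPhi e f` compares `e` with `φ * f`, where `φ` is the real threshold that is a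
parameter of the machine; this is the only access a program has to `φ`. -/
inductive Test where
  | lt (e f : Expr)
  | ltPhi (e f : Expr)

/-- Programs. `rand r e` puts a uniformly random element of `{0, …, e - 1}` into register `r`
(zero if `e = 0`); `loop r e c` evaluates `e` once, and then executes `c` that many times, with
register `r` set to `0, 1, 2, …` before the successive rounds. -/
inductive Cmd where
  | skip
  | set (r : ℕ) (e : Expr)
  | write (a : ℕ) (e f : Expr)
  | rand (r : ℕ) (e : Expr)
  | seq (c d : Cmd)
  | ite (t : Test) (c d : Cmd)
  | loop (r : ℕ) (e : Expr) (c : Cmd)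

/-- Machine states. The `clock` counts the elementary operations executed so far; programs cannot
read it. -/
structure State where
  reg : ℕ → ℕ
  mem : ℕ → ℕ → ℕ
  clock : ℕ

namespace State

def tick (k : ℕ) (s : State) : State := { s with clock := s.clock + k }

def setReg (r x : ℕ) (s : State) : State := { s with reg := Function.update s.reg r x }

def setMem (a x y : ℕ) (s : State) : State :=
  { s with mem := Function.update s.mem a (Function.update (s.mem a) x y) }

end State

/-- The cost of evaluating an expression: the number of its nodes. -/
def Expr.cost : Expr → ℕ
  | .lit _ => 1
  | .reg _ => 1
  | .read _ e => e.cost + 1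
  | .add e f => e.cost + f.cost + 1
  | .sub e f => e.cost + f.cost + 1
  | .mul e f => e.cost + f.cost + 1
  | .div e f => e.cost + f.cost + 1
  | .deg e => e.cost + 1
  | .nbr e f => e.cost + f.cost + 1

def Test.cost : Test → ℕ
  | .lt e f => e.cost + f.cost + 1
  | .ltPhi e f => e.cost + f.cost + 1

section Semantics

variable {n : ℕ} (G : Multigraph n) (φ : ℝ) (M : ℕ)

/-- The answer to a degree query (zero if `x` is not a vertex). -/
def degQuery (x : ℕ) : ℕ := if h : x < n then G.deg ⟨x, h⟩ else 0

/-- The answer to an adjacency list query (zero if `x` is not a vertex or `k` is not a position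
of its list). -/
def nbrQuery (x k : ℕ) : ℕ :=
  if h : x < n then ((G.nbrs ⟨x, h⟩)[k]?.map Fin.val).getD 0 else 0

def Expr.eval (s : State) : Expr → ℕ
  | .lit k => k % M
  | .reg r => s.reg r
  | .read a e => s.mem a (e.eval s)
  | .add e f => (e.eval s + f.eval s) % M
  | .sub e f => e.eval s - f.eval s
  | .mul e f => (e.eval s * f.eval s) % M
  | .div e f => e.eval s / f.eval s
  | .deg e => degQuery G (e.eval s) % M
  | .nbr e f => nbrQuery G (e.eval s) (f.eval s) % M

def Test.holds (s : State) : Test → Prop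
  | .lt e f => e.eval G M s < f.eval G M s
  | .ltPhi e f => (e.eval G M s : ℝ) < φ * (f.eval G M s : ℝ)

/-- The uniform distribution on `{0, …, k - 1}` (the point mass at zero if `k = 0`). -/
noncomputable def uniformBelow : ℕ → PMF ℕ
  | 0 => PMF.pure 0
  | k + 1 => (PMF.uniformOfFintype (Fin (k + 1))).map Fin.val

/-- Execute `f 0`, `f 1`, …, `f (k - 1)` one after the other. -/
noncomputable def rounds (f : ℕ → State → PMF State) : ℕ → State → PMF State
  | 0, s => PMF.pure s
  | k + 1, s => (rounds f k s).bind (f k)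

open Classical in
/-- The distribution of the final state of a program started in the state `s`. -/
noncomputable def Cmd.exec : Cmd → State → PMF State
  | .skip, s => PMF.pure (s.tick 1)
  | .set r e, s => PMF.pure ((s.setReg r (e.eval G M s)).tick (e.cost + 1))
  | .write a e f, s =>
      PMF.pure ((s.setMem a (e.eval G M s) (f.eval G M s)).tick (e.cost + f.cost + 1))
  | .rand r e, s =>
      (uniformBelow (e.eval G M s)).map fun x => (s.setReg r x).tick (e.cost + 1)
  | .seq c d, s => (c.exec s).bind d.exec
  | .ite t c d, s =>
      if t.holds G φ M s then c.exec (s.tick (t.cost + 1)) else d.exec (s.tick (t.cost + 1))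
  | .loop r e c, s =>
      rounds (fun k s' => c.exec ((s'.setReg r k).tick 1)) (e.eval G M s) (s.tick (e.cost + 1))

end Semantics

/-- The initial state: registers `1, …, 5` hold the inputs, everything else is zero. -/
def initState (M x₁ x₂ x₃ x₄ x₅ : ℕ) : State where
  reg r := match r with
    | 1 => x₁ % M
    | 2 => x₂ % M
    | 3 => x₃ % M
    | 4 => x₄ % M
    | 5 => x₅ % M
    | _ => 0
  mem _ _ := 0
  clock := 0

/-- A final state outputs the vertex set `S` if register `0` holds a positive number `k` and the
first `k` cells of array `0` list the elements of `S`. -/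
def OutputsSet {n : ℕ} (s : State) (S : Finset (Fin n)) : Prop :=
  0 < s.reg 0 ∧ (∀ t < s.reg 0, s.mem 0 t < n) ∧
    ∀ v : Fin n, v ∈ S ↔ ∃ t < s.reg 0, s.mem 0 t = v

/-- A final state without an output set is the declaration that the walk has mixed. -/
def Declares (s : State) : Prop := s.reg 0 = 0

end RAM

/-- The answer in the final state `s` is right: it is a proper non-empty vertex set of conductance
less than `φ`, or it is the declaration and indeed `max_j p^ℓ_j / (2 d_j) ≤ 256 α`. -/
def CorrectAnswer {n : ℕ} (G : Multigraph n) (i : Fin n) (ℓ : ℕ) (α φ : ℝ) (s : RAM.State) :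
    Prop :=
  (∃ S : Finset (Fin n), RAM.OutputsSet s S ∧ S.Nonempty ∧ Sᶜ.Nonempty ∧ G.conductance S < φ) ∨
    (RAM.Declares s ∧ ∀ j, G.walkProb i ℓ j / (2 * G.deg j) ≤ 256 * α)

/-- The distribution of the final state of the program `P` on the graph `G`, with start vertex `i`,
walk length `ℓ`, parameter `α` (supplied as the word `⌈1/α⌉`), threshold `φ`, and words of
`c` times the bit length of `m` bits. -/
noncomputable def runProgram {n : ℕ} (P : RAM.Cmd) (c : ℕ) (G : Multigraph n) (i : Fin n) (ℓ : ℕ)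
    (α φ : ℝ) : PMF RAM.State :=
  P.exec G φ (2 ^ (c * Nat.size G.totalDeg))
    (RAM.initState (2 ^ (c * Nat.size G.totalDeg)) n G.totalDeg i ℓ ⌈1 / α⌉₊)

open scoped ENNReal

/-! ### Degrees, cuts and scores -/

namespace Multigraph

variable {n : ℕ} (G : Multigraph n)

/-! The algorithm repeatedly runs the evolving set process from `{i}`: given `S` and a uniform
threshold `U`, the next set consists of the vertices whose probability of stepping into `S` is at
least `U`. Thresholds are discretised to multiples of `1/W` with `W = 4mℓ`.

Averaging over `U` recovers one step of the walk, so the process is dual to the walk: the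
probability that the walk from `j` is in `S` after `s + 1` steps is, up to a factor `1 - ε` for
rounding, at most the mean over the next set of the same probability after `s` steps
(`hitProb_succ_le`). The weight of the set does not grow on average (`sum_weight_evolve_le`). If the
cut of `S` is at least `φ` times its weight, the thresholds up to `1/2` and those above give mean
weights at most `1 + 2x` and `1 - 2x` times the old one, where `x ≥ φ` is the ratio of cut to
weight; by concavity the mean of the square root of the weight shrinks by the factor `decay φ`
(`sum_sqrt_weight_evolve_le`).

So a walk from `j` can be in `S` after `s` steps only on account of three events: the process meets
a sparse cut, its weight exceeds `B = ⌈1/α⌉`, or it stays alive although the square root of its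
weight decays. This is `hitProb_le`. By reversibility, `p_j / (2 d_j)` is the probability of walking
from `j` to `i`, divided by `w = 2 d_i`. If it exceeds `256 α` for some `j`, then `decay φ ^ ℓ ≤ α`
makes the last two contributions small, and one run finds a sparse cut with probability at least `α
w` (`failProb_le`).

About `ℓB/w` runs all fail with probability at most `exp (-ℓ)`. A step costs time proportional to
the weight of the set, so the expected total weight is at most `2ℓ²B`, and a budget of `ℓ³B` is
exceeded with probability at most `2/ℓ` (`pow_add_div_le`). The error is one-sided, as every output
set has been tested. On the machine, `wp` tracks what holds in every execution, including the clock,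
and `expect` bounds the failure probability through a potential that is a supermartingale
(`expect_evolveStep_potential_le`). -/

lemma mult_comm (u v : Fin n) : G.mult u v = G.mult v u := G.symm u v

lemma sum_mult (u : Fin n) : ∑ v, G.mult u v = G.deg u := by
  have := Multiset.sum_count_eq_card (s := Finset.univ) (m := (G.nbrs u : Multiset (Fin n)))
    (fun a _ => Finset.mem_univ a)
  simpa [mult, deg] using this

/-- The number of edges between `S` and `v`. -/
def links (S : Finset (Fin n)) (v : Fin n) : ℕ := ∑ u ∈ S, G.mult u v

/-- The numerator of the probability `score S v / (2 d_v)` that one step leads from `v` to `S`. -/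
def score (S : Finset (Fin n)) (v : Fin n) : ℕ := (if v ∈ S then G.deg v else 0) + G.links S v

lemma links_le_deg (S : Finset (Fin n)) (v : Fin n) : G.links S v ≤ G.deg v := by
  rw [← G.sum_mult v, links]
  simp_rw [G.mult_comm v]
  exact Finset.sum_le_sum_of_subset (Finset.subset_univ S)

lemma score_le (S : Finset (Fin n)) (v : Fin n) : G.score S v ≤ 2 * G.deg v := by
  have := G.links_le_deg S v
  unfold score
  split_ifs <;> omega

lemma score_insert {S : Finset (Fin n)} {u : Fin n} (h : u ∉ S) (v : Fin n) :
    G.score (insert u S) v = G.score S v + (if v = u then G.deg u else 0) + G.mult u v := by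
  unfold score links
  rw [Finset.sum_insert h]
  by_cases hv : v = u
  · subst hv; simp [h]; ring
  · simp [hv]; ring

lemma deg_le_totalDeg (v : Fin n) : G.deg v ≤ G.totalDeg :=
  Finset.single_le_sum (f := G.deg) (fun _ _ => Nat.zero_le _) (Finset.mem_univ v)

lemma weight_mono {S T : Finset (Fin n)} (h : S ⊆ T) : G.weight S ≤ G.weight T :=
  Finset.sum_le_sum_of_subset h

lemma weight_univ : G.weight Finset.univ = 2 * G.totalDeg := by
  simp [weight, totalDeg, Finset.mul_sum]

lemma weight_le (S : Finset (Fin n)) : G.weight S ≤ 2 * G.totalDeg :=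
  G.weight_univ ▸ G.weight_mono (Finset.subset_univ S)

lemma weight_compl (S : Finset (Fin n)) : G.weight S + G.weight Sᶜ = 2 * G.totalDeg := by
  rw [← G.weight_univ]
  exact Finset.sum_add_sum_compl S _

lemma sum_compl_links (S : Finset (Fin n)) : ∑ v ∈ Sᶜ, G.links S v = G.cutSize S := by
  unfold links cutSize
  exact Finset.sum_comm

lemma sum_links_add_cutSize (S : Finset (Fin n)) :
    2 * ∑ v ∈ S, G.links S v + 2 * G.cutSize S = G.weight S := by
  have h : ∑ v ∈ S, G.links S v + G.cutSize S = ∑ v ∈ S, G.deg v := by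
    unfold links cutSize
    rw [Finset.sum_comm, ← Finset.sum_add_distrib]
    refine Finset.sum_congr rfl fun u _ => ?_
    rw [Finset.sum_add_sum_compl, sum_mult]
  rw [← mul_add, h, weight, Finset.mul_sum]

/-- Summing over `S` counts each self-loop and each inner edge in full and misses exactly the cut
edges. The program thus obtains the cut without looking at the complement. -/
lemma sum_score_add_cutSize (S : Finset (Fin n)) :
    ∑ v ∈ S, G.score S v + G.cutSize S = G.weight S := by
  have h := G.sum_links_add_cutSize S
  have h1 : 2 * ∑ v ∈ S, G.score S v = G.weight S + 2 * ∑ v ∈ S, G.links S v := by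
    unfold score weight
    rw [Finset.sum_add_distrib, mul_add, Finset.mul_sum]
    congr 1
    exact Finset.sum_congr rfl fun v hv => by simp [hv]
  omega

/-! ### The evolving set process: weight and square root of the weight -/

/-- One step of the evolving set process with discretised threshold `r + 1` out of `W`. -/
def evolve (W : ℕ) (S : Finset (Fin n)) (r : ℕ) : Finset (Fin n) :=
  Finset.univ.filter fun v => 2 * G.deg v * (r + 1) ≤ W * G.score S v

lemma card_threshold_mul_le (H d e : ℕ) :
    ((Finset.range H).filter fun r => d * (r + 1) ≤ H * e).card * d ≤ H * e := by
  rcases Nat.eq_zero_or_pos d with rfl | hd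
  · simp
  · have : ((Finset.range H).filter fun r => d * (r + 1) ≤ H * e) ⊆ Finset.range (H * e / d) := by
      intro r hr
      rw [Finset.mem_filter] at hr
      rw [Finset.mem_range, ← Nat.succ_le_iff, Nat.le_div_iff_mul_le hd, Nat.succ_eq_add_one,
        mul_comm]
      exact hr.2
    calc _ ≤ (H * e / d) * d := by
          gcongr; simpa using Finset.card_le_card this
      _ ≤ _ := Nat.div_mul_le_self _ _

lemma sum_weight_eq (W H a : ℕ) (S : Finset (Fin n)) :
    ∑ r ∈ Finset.range H, G.weight (G.evolve W S (a + r)) =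
      ∑ v, ((Finset.range H).filter fun r =>
        2 * G.deg v * (a + r + 1) ≤ W * G.score S v).card * (2 * G.deg v) := by
  unfold weight evolve
  simp_rw [Finset.sum_filter]
  rw [Finset.sum_comm]
  refine Finset.sum_congr rfl fun v _ => ?_
  rw [← Finset.sum_filter, Finset.sum_const, smul_eq_mul]

/-- For thresholds up to `1/2`, count the vertices of `S` as always staying; an outer vertex enters
for a fraction of at most `links / deg` of them, which adds up to twice the cut. -/
lemma sum_weight_low (H : ℕ) (S : Finset (Fin n)) :
    ∑ r ∈ Finset.range H, G.weight (G.evolve (2 * H) S r) ≤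
      H * (G.weight S + 2 * G.cutSize S) := by
  have h := G.sum_weight_eq (2 * H) H 0 S
  simp only [zero_add] at h
  rw [h, ← Finset.sum_add_sum_compl S, ← G.sum_compl_links, mul_add]
  refine add_le_add ?_ ?_
  · unfold weight
    rw [Finset.mul_sum]
    refine Finset.sum_le_sum fun v _ => ?_
    gcongr
    exact (Finset.card_filter_le _ _).trans (by simp)
  · rw [Finset.mul_sum, Finset.mul_sum]
    refine Finset.sum_le_sum fun v hv => ?_
    have := card_threshold_mul_le H (G.deg v) (G.links S v)
    have e : ∀ r, 2 * G.deg v * (r + 1) ≤ 2 * H * G.score S v ↔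
        G.deg v * (r + 1) ≤ H * G.links S v := by
      intro r
      simp only [score, Finset.mem_compl.1 hv, if_false, zero_add, mul_assoc]
      omega
    simp only [e]
    linarith

/-- By laziness an outer vertex steps into `S` with probability at most `1/2`, so it never passes a
threshold above `1/2`; an inner vertex passes at most a fraction `links / deg` of them. -/
lemma sum_weight_high (H : ℕ) (hd : ∀ v, 0 < G.deg v) (S : Finset (Fin n)) :
    ∑ r ∈ Finset.range H, G.weight (G.evolve (2 * H) S (H + r)) + H * (2 * G.cutSize S) ≤
      H * G.weight S := by
  rw [← G.sum_links_add_cutSize S, mul_add]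
  gcongr
  rw [G.sum_weight_eq, ← Finset.sum_add_sum_compl S]
  have h2 : ∑ v ∈ Sᶜ, ((Finset.range H).filter fun r =>
        2 * G.deg v * (H + r + 1) ≤ 2 * H * G.score S v).card * (2 * G.deg v) = 0 := by
    refine Finset.sum_eq_zero fun v hv => ?_
    rw [Finset.filter_false_of_mem, Finset.card_empty, zero_mul]
    intro r _
    have := G.links_le_deg S v
    simp only [score, Finset.mem_compl.1 hv, if_false, zero_add]
    have := hd v
    nlinarith [Nat.zero_le (G.deg v * r), Nat.mul_le_mul_left H (G.links_le_deg S v)]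
  rw [h2, add_zero, Finset.mul_sum, Finset.mul_sum]
  refine Finset.sum_le_sum fun v hv => ?_
  have := card_threshold_mul_le H (G.deg v) (G.links S v)
  have e : ∀ r, 2 * G.deg v * (H + r + 1) ≤ 2 * H * G.score S v ↔
      G.deg v * (r + 1) ≤ H * G.links S v := by
    intro r
    simp only [score, hv, if_true, mul_assoc, mul_add]
    rw [mul_comm H (G.deg v)]
    omega
  simp only [e]
  linarith

lemma sum_weight_evolve_le (H : ℕ) (hd : ∀ v, 0 < G.deg v) (S : Finset (Fin n)) :
    ∑ r ∈ Finset.range (2 * H), G.weight (G.evolve (2 * H) S r) ≤ 2 * H * G.weight S := by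
  have h1 := G.sum_weight_low H S
  have h2 := G.sum_weight_high H hd S
  rw [two_mul H, Finset.sum_range_add, ← two_mul H]
  linarith

/-- Jensen's inequality for the square root, via its tangent at `a`; for `a ≤ 0` all terms vanish.
-/
lemma sum_sqrt_le {H : ℕ} {x : ℕ → ℝ} {a : ℝ} (hx : ∀ r, 0 ≤ x r)
    (h : ∑ r ∈ Finset.range H, x r ≤ H * a) :
    ∑ r ∈ Finset.range H, √(x r) ≤ H * √a := by
  rcases lt_or_ge 0 a with ha | ha
  · have hs : 0 < √a := Real.sqrt_pos.2 ha
    have : ∀ r ∈ Finset.range H, √(x r) ≤ x r / (2 * √a) + √a / 2 := by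
      intro r _
      rw [div_add_div _ _ (by positivity) two_ne_zero, le_div_iff₀ (by positivity)]
      nlinarith [sq_nonneg (√(x r) - √a), Real.sq_sqrt (hx r), Real.sq_sqrt ha.le]
    refine (Finset.sum_le_sum this).trans ?_
    rw [Finset.sum_add_distrib, ← Finset.sum_div, Finset.sum_const, Finset.card_range,
      nsmul_eq_mul]
    have h3 : (∑ r ∈ Finset.range H, x r) / (2 * √a) ≤ H * √a / 2 := by
      rw [div_le_iff₀ (by positivity)]
      nlinarith [Real.sq_sqrt ha.le]
    linarith
  · have h0 : ∑ r ∈ Finset.range H, x r ≤ 0 :=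
      h.trans (mul_nonpos_of_nonneg_of_nonpos (Nat.cast_nonneg _) ha)
    have h1 : ∀ r ∈ Finset.range H, x r = 0 :=
      (Finset.sum_eq_zero_iff_of_nonneg fun r _ => hx r).1
        (le_antisymm h0 (Finset.sum_nonneg fun r _ => hx r))
    rw [Finset.sum_congr rfl fun r hr => by rw [h1 r hr]]
    simp only [Real.sqrt_zero, Finset.sum_const_zero]
    positivity

/-- After squaring, only the cross term `√(w² - c²)` depends on `c`, and it decreases. This lets the
actual cut be replaced by its lower bound. -/
lemma sqrt_add_sqrt_sub_le {w c b : ℝ} (hb : 0 ≤ b) (hbc : b ≤ c) (hc : c ≤ w) :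
    √(w + c) + √(w - c) ≤ √(w + b) + √(w - b) := by
  refine abs_le_of_sq_le_sq' ?_ (by positivity) |>.2
  have h1 := Real.sq_sqrt (show 0 ≤ w + c by linarith)
  have h2 := Real.sq_sqrt (show 0 ≤ w - c by linarith)
  have h3 := Real.sq_sqrt (show 0 ≤ w + b by linarith)
  have h4 := Real.sq_sqrt (show 0 ≤ w - b by linarith)
  have h5 : √(w + c) * √(w - c) ≤ √(w + b) * √(w - b) := by
    rw [← Real.sqrt_mul (by linarith), ← Real.sqrt_mul (by linarith)]
    exact Real.sqrt_le_sqrt (by nlinarith)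
  nlinarith

/-- The decay factor of the square root of the volume. -/
noncomputable def decay (φ : ℝ) : ℝ := 1 / 2 * (√(1 - 2 * φ) + √(1 + 2 * φ))

lemma decay_nonneg (φ : ℝ) : 0 ≤ decay φ := by unfold decay; positivity

lemma sum_sqrt_weight_evolve_le (H : ℕ) (hd : ∀ v, 0 < G.deg v) (S : Finset (Fin n)) {φ : ℝ}
    (h0 : 0 ≤ φ) (hS : φ * G.weight S ≤ G.cutSize S) :
    ∑ r ∈ Finset.range (2 * H), √(G.weight (G.evolve (2 * H) S r) : ℝ) ≤
      (2 * H : ℕ) * (decay φ * √(G.weight S : ℝ)) := by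
  have h1 : ((∑ r ∈ Finset.range H, G.weight (G.evolve (2 * H) S r) : ℕ) : ℝ) ≤
      ((H * (G.weight S + 2 * G.cutSize S) : ℕ) : ℝ) := by exact_mod_cast G.sum_weight_low H S
  have h2 : ((∑ r ∈ Finset.range H, G.weight (G.evolve (2 * H) S (H + r)) +
      H * (2 * G.cutSize S) : ℕ) : ℝ) ≤ ((H * G.weight S : ℕ) : ℝ) := by
    exact_mod_cast G.sum_weight_high H hd S
  push_cast at h1 h2
  have h3 := sum_sqrt_le (fun r => Nat.cast_nonneg _) h1
  have h4 := sum_sqrt_le (a := G.weight S - 2 * G.cutSize S) (fun r => Nat.cast_nonneg _)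
    (by linarith : ∑ r ∈ Finset.range H, (G.weight (G.evolve (2 * H) S (H + r)) : ℝ) ≤ _)
  have hc : 2 * (G.cutSize S : ℝ) ≤ G.weight S := by
    have := G.sum_links_add_cutSize S
    exact_mod_cast (by omega : 2 * G.cutSize S ≤ G.weight S)
  have h5 := sqrt_add_sqrt_sub_le (w := G.weight S) (c := 2 * G.cutSize S)
    (b := 2 * (φ * G.weight S)) (by positivity) (by linarith) hc
  have h6 : √((G.weight S : ℝ) + 2 * (φ * G.weight S)) + √((G.weight S : ℝ) - 2 * (φ * G.weight S)) =
      2 * (decay φ * √(G.weight S : ℝ)) := by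
    have e1 : (G.weight S : ℝ) + 2 * (φ * G.weight S) = G.weight S * (1 + 2 * φ) := by ring
    have e2 : (G.weight S : ℝ) - 2 * (φ * G.weight S) = G.weight S * (1 - 2 * φ) := by ring
    rw [e1, e2, Real.sqrt_mul (Nat.cast_nonneg _), Real.sqrt_mul (Nat.cast_nonneg _), decay]
    ring
  rw [two_mul H, Finset.sum_range_add, ← two_mul H]
  push_cast
  nlinarith [mul_le_mul_of_nonneg_left (h5.trans_eq h6) (Nat.cast_nonneg (α := ℝ) H)]

/-! ### The lazy walk and its duality with the process -/

lemma sum_lazyMatrix (hd : ∀ v, 0 < G.deg v) (S : Finset (Fin n)) (u : Fin n) :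
    ∑ v ∈ S, G.lazyMatrix u v = (G.score S u : ℝ) / (2 * G.deg u) := by
  have h : (G.deg u : ℝ) ≠ 0 := by exact_mod_cast (hd u).ne'
  unfold lazyMatrix score links
  rw [Finset.sum_add_distrib, Finset.sum_ite_eq, ← Finset.sum_div]
  push_cast
  rw [add_div]
  congr 1
  · split_ifs
    · field_simp
    · simp
  · simp_rw [G.mult_comm u]

lemma lazyMatrix_nonneg (u v : Fin n) : 0 ≤ G.lazyMatrix u v := by
  unfold lazyMatrix
  split_ifs <;> positivity

lemma lazyMatrix_reversible (hd : ∀ v, 0 < G.deg v) (l : ℕ) (u v : Fin n) :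
    G.deg u * (G.lazyMatrix ^ l) u v = G.deg v * (G.lazyMatrix ^ l) v u := by
  have base : ∀ u v, (G.deg u : ℝ) * G.lazyMatrix u v = G.deg v * G.lazyMatrix v u := by
    intro u v
    have h : (G.deg u : ℝ) ≠ 0 := by exact_mod_cast (hd u).ne'
    have h' : (G.deg v : ℝ) ≠ 0 := by exact_mod_cast (hd v).ne'
    unfold lazyMatrix
    rw [G.mult_comm v u]
    by_cases e : u = v
    · subst e; rfl
    · simp only [e, Ne.symm e, if_false, zero_add]
      field_simp
  induction l generalizing u v with
  | zero => 
    by_cases e : u = v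
    · subst e; rfl
    · simp [e, Ne.symm e]
  | succ l ih =>
    rw [pow_succ, Matrix.mul_apply, ← pow_succ, pow_succ', Matrix.mul_apply, Finset.mul_sum,
      Finset.mul_sum]
    refine Finset.sum_congr rfl fun x _ => ?_
    rw [← mul_assoc, ih, mul_right_comm, base, ← mul_assoc, mul_right_comm]

/-- The probability that the walk from `j` is in `S` after `l` steps. -/
noncomputable def hitProb (l : ℕ) (S : Finset (Fin n)) (j : Fin n) : ℝ :=
  ∑ v ∈ S, (G.lazyMatrix ^ l) j v

lemma pow_lazyMatrix_nonneg (l : ℕ) (u v : Fin n) : 0 ≤ (G.lazyMatrix ^ l) u v := by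
  induction l generalizing u v with
  | zero => rw [pow_zero, Matrix.one_apply]; split_ifs <;> norm_num
  | succ l ih =>
    rw [pow_succ, Matrix.mul_apply]
    exact Finset.sum_nonneg fun x _ => mul_nonneg (ih _ _) (G.lazyMatrix_nonneg _ _)

lemma hitProb_succ (hd : ∀ v, 0 < G.deg v) (l : ℕ) (S : Finset (Fin n)) (j : Fin n) :
    G.hitProb (l + 1) S j =
      ∑ u, (G.lazyMatrix ^ l) j u * ((G.score S u : ℝ) / (2 * G.deg u)) := by
  unfold hitProb
  simp_rw [pow_succ, Matrix.mul_apply]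
  rw [Finset.sum_comm]
  refine Finset.sum_congr rfl fun u _ => ?_
  rw [← Finset.mul_sum, G.sum_lazyMatrix hd]

lemma hitProb_le_one (hd : ∀ v, 0 < G.deg v) (l : ℕ) (S : Finset (Fin n)) (j : Fin n) :
    G.hitProb l S j ≤ 1 := by
  induction l generalizing S with
  | zero =>
    unfold hitProb
    simp only [pow_zero, Matrix.one_apply, Finset.sum_ite_eq]
    split_ifs <;> norm_num
  | succ l ih =>
    refine le_trans ?_ (ih Finset.univ)
    rw [G.hitProb_succ hd, hitProb]
    refine Finset.sum_le_sum fun u _ => mul_le_of_le_one_right (G.pow_lazyMatrix_nonneg _ _ _) ?_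
    have : (0 : ℝ) < G.deg u := by exact_mod_cast hd u
    rw [div_le_one (by positivity)]
    exact_mod_cast G.score_le S u

lemma card_evolve_mem (hd : ∀ v, 0 < G.deg v) (W : ℕ) (S : Finset (Fin n)) (v : Fin n) :
    ((Finset.range W).filter fun r => v ∈ G.evolve W S r).card =
      W * G.score S v / (2 * G.deg v) := by
  have h2 : 0 < 2 * G.deg v := by have := hd v; omega
  rw [← Finset.card_range (W * G.score S v / (2 * G.deg v))]
  congr 1
  ext r
  simp only [Finset.mem_filter, Finset.mem_range, evolve, Finset.mem_univ, true_and]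
  rw [← Nat.succ_le_iff (n := W * G.score S v / (2 * G.deg v)), Nat.le_div_iff_mul_le h2,
    Nat.succ_eq_add_one, mul_comm (r + 1)]
  refine and_iff_right_of_imp fun h => ?_
  have h3 := h.trans (Nat.mul_le_mul_left W (G.score_le S v))
  rw [mul_comm W] at h3
  exact Nat.le_of_mul_le_mul_left h3 h2

/-- Rounding down loses less than one threshold. A non-zero score is at least `1`, so an `ε`
fraction of its `W * score / (2 d_v)` thresholds is at least `2m / (2 d_v) ≥ 1` and covers the loss.
-/
lemma score_le_avg (hd : ∀ v, 0 < G.deg v) {W : ℕ} {ε : ℝ} (hε : 2 * (G.totalDeg : ℝ) ≤ ε * W)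
    (S : Finset (Fin n)) (v : Fin n) :
    (1 - ε) * ((G.score S v : ℝ) / (2 * G.deg v)) * W ≤
      (((Finset.range W).filter fun r => v ∈ G.evolve W S r).card : ℝ) := by
  have hd0 : (0 : ℝ) < G.deg v := by exact_mod_cast hd v
  have hd' : (0 : ℝ) < 2 * G.deg v := by positivity
  rcases Nat.eq_zero_or_pos (G.score S v) with h | h
  · rw [h]; simp
  · rw [G.card_evolve_mem hd]
    have h1 := Nat.lt_floor_add_one ((W * G.score S v : ℝ) / (2 * G.deg v))
    have h2 : ⌊(W * G.score S v : ℝ) / (2 * G.deg v)⌋₊ = W * G.score S v / (2 * G.deg v) := by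
      exact_mod_cast Nat.floor_div_eq_div (K := ℝ) (W * G.score S v) (2 * G.deg v)
    rw [h2] at h1
    have h3 : 1 ≤ ε * W * ((G.score S v : ℝ) / (2 * G.deg v)) := by
      rw [mul_div_assoc', le_div_iff₀ hd', one_mul]
      have h4 : (1 : ℝ) ≤ G.score S v := by exact_mod_cast h
      have h5 : (G.deg v : ℝ) ≤ G.totalDeg := by exact_mod_cast G.deg_le_totalDeg v
      have h6 : 0 ≤ ε * W := le_trans (by positivity) hε
      nlinarith
    have h7 : (W * G.score S v : ℝ) / (2 * G.deg v) = (G.score S v : ℝ) / (2 * G.deg v) * W := by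
      ring
    rw [h7] at h1
    linarith

lemma hitProb_succ_le (hd : ∀ v, 0 < G.deg v) {W : ℕ} {ε : ℝ}
    (hε : 2 * (G.totalDeg : ℝ) ≤ ε * W) (l : ℕ) (S : Finset (Fin n)) (j : Fin n) :
    (1 - ε) * G.hitProb (l + 1) S j * W ≤
      ∑ r ∈ Finset.range W, G.hitProb l (G.evolve W S r) j := by
  rw [G.hitProb_succ hd]
  have : ∀ r, G.hitProb l (G.evolve W S r) j =
      ∑ u, if u ∈ G.evolve W S r then (G.lazyMatrix ^ l) j u else 0 := by
    intro r; simp [hitProb]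
  simp_rw [this]
  rw [Finset.sum_comm, Finset.mul_sum, Finset.sum_mul]
  refine Finset.sum_le_sum fun u _ => ?_
  rw [← Finset.sum_filter, Finset.sum_const, nsmul_eq_mul]
  have := mul_le_mul_of_nonneg_left (G.score_le_avg hd hε S u) (G.pow_lazyMatrix_nonneg l j u)
  linarith

/-! ### Success probability of a single run -/

open Classical in
/-- The probability that `s` steps of the evolving set process from `S`, which is stopped when the
set is empty or has weight more than `B`, do not meet a set of conductance less than `φ`. -/
noncomputable def failProb (W B : ℕ) (φ : ℝ) : ℕ → Finset (Fin n) → ℝ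
  | 0, _ => 1
  | s + 1, S =>
    if S = ∅ ∨ B < G.weight S then 1
    else if (G.cutSize S : ℝ) < φ * G.weight S then 0
    else (∑ r ∈ Finset.range W, failProb W B φ s (G.evolve W S r)) / W

lemma failProb_nonneg (W B : ℕ) (φ : ℝ) (s : ℕ) (S : Finset (Fin n)) :
    0 ≤ G.failProb W B φ s S := by
  induction s generalizing S with
  | zero => simp [failProb]
  | succ s ih =>
    unfold failProb
    split_ifs
    · norm_num
    · norm_num
    · exact div_nonneg (Finset.sum_nonneg fun r _ => ih _) (Nat.cast_nonneg _)

lemma failProb_stopped {W B : ℕ} {φ : ℝ} {S : Finset (Fin n)} (h : S = ∅ ∨ B < G.weight S)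
    (s : ℕ) : G.failProb W B φ s S = 1 := by
  cases s with
  | zero => rfl
  | succ s => rw [failProb, if_pos h]

/-- Induction over the steps. Each summand pays for one way to stop: success, excessive weight (as
in Markov's inequality), or survival. Averaging over the next set preserves the bound, since the
weight does not grow and its square root contracts while the cut is not sparse. -/
theorem hitProb_le (hd : ∀ v, 0 < G.deg v) {H B : ℕ} (hH : 0 < H) (hB : 0 < B) {φ ε : ℝ}
    (h0 : 0 ≤ φ) (hε : 2 * (G.totalDeg : ℝ) ≤ ε * (2 * H : ℕ)) (hε0 : 0 ≤ ε) (hε1 : ε ≤ 1)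
    (s : ℕ) (S : Finset (Fin n)) (j : Fin n) :
    (1 - ε) ^ s * G.hitProb s S j ≤ (1 - G.failProb (2 * H) B φ s S) + G.weight S / B +
      decay φ ^ s * √(G.weight S : ℝ) := by
  have hs1 : ∀ s S, (1 - ε) ^ s * G.hitProb s S j ≤ 1 := fun s S =>
    mul_le_one₀ (pow_le_one₀ (by linarith) (by linarith))
      (Finset.sum_nonneg fun v _ => G.pow_lazyMatrix_nonneg _ _ _) (G.hitProb_le_one hd s S j)
  have hdec : ∀ s (S : Finset (Fin n)), 0 ≤ decay φ ^ s * √(G.weight S : ℝ) := fun s S =>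
    mul_nonneg (pow_nonneg (decay_nonneg φ) _) (Real.sqrt_nonneg _)
  have hB' : (0 : ℝ) < B := by exact_mod_cast hB
  have hw : ∀ S : Finset (Fin n), 0 ≤ (G.weight S : ℝ) / B := fun S => by positivity
  induction s generalizing S with
  | zero =>
    rcases S.eq_empty_or_nonempty with rfl | ⟨v, hv⟩
    · simp [hitProb, failProb, weight]
    -- Here `failProb` is `1`, so the square-root term has to pay alone; a non-empty set has weight
    -- at least `2`.
    · have h1 : (1 : ℝ) ≤ √(G.weight S : ℝ) := by
        rw [Real.one_le_sqrt]
        have h2 : 2 * G.deg v ≤ G.weight S :=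
          Finset.single_le_sum (f := fun u => 2 * G.deg u) (fun _ _ => Nat.zero_le _) hv
        have h3 := hd v
        exact_mod_cast (by omega : 1 ≤ G.weight S)
      have h4 := hs1 0 S
      have h5 := hw S
      simp only [failProb, pow_zero, one_mul, sub_self, zero_add] at h4 ⊢
      linarith
  | succ s ih =>
    by_cases h1 : S = ∅ ∨ B < G.weight S
    · rw [failProb, if_pos h1]
      rcases h1 with rfl | h1
      · simp [hitProb, weight]
      · have h2 : 1 ≤ (G.weight S : ℝ) / B := by
          rw [one_le_div hB']; exact_mod_cast h1.le
        linarith [hs1 (s + 1) S, hdec (s + 1) S]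
    by_cases h2 : (G.cutSize S : ℝ) < φ * G.weight S
    · rw [failProb, if_neg h1, if_pos h2]
      linarith [hs1 (s + 1) S, hdec (s + 1) S, hw S]
    · rw [failProb, if_neg h1, if_neg h2]
      have hW : (0 : ℝ) < (2 * H : ℕ) := by exact_mod_cast (by omega : 0 < 2 * H)
      obtain ⟨W, hWdef⟩ : ∃ W, W = 2 * H := ⟨_, rfl⟩
      rw [← hWdef] at hW hε ih ⊢
      have k1 := mul_le_mul_of_nonneg_left (G.hitProb_succ_le hd hε s S j)
        (pow_nonneg (sub_nonneg.2 hε1) s)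
      rw [Finset.mul_sum] at k1
      have k2 := k1.trans (Finset.sum_le_sum fun r _ => ih (G.evolve W S r))
      have k3 : ((∑ r ∈ Finset.range W, G.weight (G.evolve W S r) : ℕ) : ℝ) ≤
          ((W * G.weight S : ℕ) : ℝ) := by
        rw [hWdef]; exact_mod_cast G.sum_weight_evolve_le H hd S
      have k4 := G.sum_sqrt_weight_evolve_le H hd S h0 (not_lt.1 h2)
      rw [← hWdef] at k4
      simp only [Finset.sum_add_distrib, Finset.sum_sub_distrib, ← Finset.mul_sum,
        ← Finset.sum_div, Finset.sum_const, Finset.card_range, nsmul_eq_mul, mul_one] at k2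
      push_cast at k3
      have k5 := mul_le_mul_of_nonneg_left k4 (pow_nonneg (decay_nonneg φ) s)
      have k6 : (∑ r ∈ Finset.range W, (G.weight (G.evolve W S r) : ℝ)) / B ≤
          W * (G.weight S / B) := by
        rw [mul_div_assoc']; gcongr
      refine le_of_mul_le_mul_right ?_ hW
      rw [add_mul, add_mul, sub_mul, div_mul_cancel₀ _ hW.ne', one_mul, pow_succ, pow_succ]
      nlinarith

/-- The decay factor is at most `1` and its logarithm is `-ζτ`, which forces `τ ≥ 0`; then `ℓ ≥ log
m / ζ` steps suffice. -/
lemma decay_pow_le {ζ τ φ m : ℝ} {l : ℕ} (hζ : 0 < ζ) (h0 : 0 ≤ φ) (h1 : φ ≤ 1 / 2)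
    (h : -Real.log (1 / 2 * (√(1 - 2 * φ) + √(1 + 2 * φ))) = ζ * τ) (hm : 0 < m)
    (hl : Real.log m / ζ ≤ l) : 0 ≤ τ ∧ decay φ ^ l ≤ m ^ (-τ) := by
  have hpos : 0 < decay φ := by
    have : 0 < √(1 + 2 * φ) := Real.sqrt_pos.2 (by linarith)
    unfold decay; positivity
  have hle : decay φ ≤ 1 := by
    have := sqrt_add_sqrt_sub_le (w := 1) (c := 2 * φ) le_rfl (by linarith) (by linarith)
    simp only [add_zero, sub_zero, Real.sqrt_one] at this
    unfold decay; linarith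
  have hlog : Real.log (decay φ) = -(ζ * τ) := by rw [← h, neg_neg, decay]
  have hτ : 0 ≤ τ := by
    have := Real.log_nonpos hpos.le hle
    rw [hlog] at this
    exact nonneg_of_mul_nonneg_right (by linarith : 0 ≤ ζ * τ) hζ
  refine ⟨hτ, ?_⟩
  rw [← Real.log_le_log_iff (by positivity) (by positivity), Real.log_pow, hlog,
    Real.log_rpow hm]
  rw [div_le_iff₀ hζ] at hl
  nlinarith

lemma weight_singleton (i : Fin n) : G.weight {i} = 2 * G.deg i := by simp [weight]

lemma walkProb_div_eq (hd : ∀ v, 0 < G.deg v) (i j : Fin n) (l : ℕ) :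
    G.walkProb i l j / (2 * G.deg j) = G.hitProb l {i} j / G.weight {i} := by
  have hi : (G.deg i : ℝ) ≠ 0 := by exact_mod_cast (hd i).ne'
  have hj : (G.deg j : ℝ) ≠ 0 := by exact_mod_cast (hd j).ne'
  have := G.lazyMatrix_reversible hd l i j
  rw [weight_singleton, walkProb, hitProb, Finset.sum_singleton]
  push_cast
  field_simp
  linarith

/-- With `w` the weight of `{i}` and `q` the failure probability, `hitProb_le` at `{i}` reads `128 α
w ≤ (1 - q) + α w + α w`, after the rounding loss has cost a factor of at most `2`. -/
theorem failProb_le (hd : ∀ v, 0 < G.deg v) {l B : ℕ} {φ α : ℝ} (hl : 0 < l) (h0 : 0 ≤ φ)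
    (hα : 0 < α) (hB : 1 / α ≤ B) (hdec : decay φ ^ l ≤ α) {i j : Fin n}
    (hj : 256 * α < G.walkProb i l j / (2 * G.deg j)) :
    G.failProb (2 * (2 * G.totalDeg * l)) B φ l {i} ≤ 1 - α * G.weight {i} := by
  have hm : 0 < G.totalDeg := (hd i).trans_le (G.deg_le_totalDeg i)
  have hl' : (1 : ℝ) ≤ l := by exact_mod_cast hl
  have hB0 : (0 : ℝ) < B := lt_of_lt_of_le (by positivity) hB
  -- For this `ε` one has exactly `2m = εW`, and `(1 - ε) ^ l ≥ 1/2` by Bernoulli's inequality.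
  have h := G.hitProb_le hd (H := 2 * G.totalDeg * l) (B := B) (φ := φ) (ε := 1 / (2 * l))
    (by positivity) (by exact_mod_cast hB0) h0
    (by push_cast; field_simp; norm_num) (by positivity)
    (by rw [div_le_one (by positivity)]; linarith) l {i} j
  have hw : (1 : ℝ) ≤ G.weight {i} := by
    rw [weight_singleton]; have := hd i; exact_mod_cast (by omega : 1 ≤ 2 * G.deg i)
  have hb : (1 : ℝ) / 2 ≤ (1 - 1 / (2 * l)) ^ l := by
    have h1 : 1 / (2 * (l : ℝ)) ≤ 1 := by rw [div_le_one (by positivity)]; linarith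
    have := one_add_mul_le_pow (a := -(1 / (2 * (l : ℝ)))) (by linarith) l
    rw [← sub_eq_add_neg 1 (1 / (2 * (l : ℝ)))] at this
    refine le_trans (le_of_eq ?_) this
    field_simp; norm_num
  rw [G.walkProb_div_eq hd, lt_div_iff₀ (by linarith)] at hj
  have h3 : (G.weight {i} : ℝ) / B ≤ α * G.weight {i} := by
    rw [div_le_iff₀ hB0]
    rw [div_le_iff₀ hα] at hB
    nlinarith
  have h4 : decay φ ^ l * √(G.weight {i} : ℝ) ≤ α * G.weight {i} := by
    refine mul_le_mul hdec ?_ (Real.sqrt_nonneg _) hα.le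
    rw [Real.sqrt_le_left (by linarith)]
    nlinarith
  have h5 := mul_le_mul hb hj.le (by positivity) (by positivity)
  have h6 : 0 < α * G.weight {i} := by positivity
  linarith

/-- Justifies the immediate declaration when the start vertex weighs more than `⌈1/α⌉`. -/
lemma walkProb_div_le (hd : ∀ v, 0 < G.deg v) (i j : Fin n) (l : ℕ) :
    G.walkProb i l j / (2 * G.deg j) ≤ 1 / G.weight {i} := by
  rw [G.walkProb_div_eq hd]
  gcongr
  exact G.hitProb_le_one hd _ _ _

/-- The total weight is `2m`, so a set of weight at most `m` attains the minimum in the conductance.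
-/
lemma conductance_lt {S : Finset (Fin n)} {φ : ℝ} (hS : S.Nonempty) (hd : ∀ v, 0 < G.deg v)
    (hw : G.weight S ≤ G.totalDeg) (hc : (G.cutSize S : ℝ) < φ * G.weight S) :
    Sᶜ.Nonempty ∧ G.conductance S < φ := by
  obtain ⟨v, hv⟩ := hS
  have h2 : 2 * G.deg v ≤ G.weight S :=
    Finset.single_le_sum (f := fun u => 2 * G.deg u) (fun _ _ => Nat.zero_le _) hv
  have h3 := hd v
  have h4 := G.weight_compl S
  constructor
  · rw [Finset.nonempty_iff_ne_empty]
    intro h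
    rw [h] at h4
    simp only [weight, Finset.sum_empty] at h4 hw h2
    omega
  · have h5 : (0 : ℝ) < G.weight S := by exact_mod_cast (by omega : 0 < G.weight S)
    rwa [conductance, min_eq_left (by omega), div_lt_iff₀ h5]

end Multigraph

/-! ### Program logic: possible final states and expectations -/

namespace RAM

section Logic

variable {n : ℕ} (G : Multigraph n) (φ : ℝ) (M : ℕ)

/-- Every possible final state of `c` started in `s` satisfies `Q`. -/
def wp (c : Cmd) (Q : State → Prop) (s : State) : Prop :=
  ∀ s' ∈ (c.exec G φ M s).support, Q s'

/-- Expectation of `f` under `p`. -/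
noncomputable def expect (p : PMF State) (f : State → ℝ≥0∞) : ℝ≥0∞ := ∑' s, p s * f s

lemma expect_pure (s : State) (f : State → ℝ≥0∞) : expect (PMF.pure s) f = f s := by
  unfold expect
  rw [tsum_eq_single s]
  · simp
  · intro t ht; simp [ht]

lemma expect_bind {β : Type} (p : PMF β) (g : β → PMF State) (f : State → ℝ≥0∞) :
    expect (p.bind g) f = ∑' x, p x * expect (g x) f := by
  unfold expect
  simp_rw [PMF.bind_apply, ← ENNReal.tsum_mul_right, ← ENNReal.tsum_mul_left]
  rw [ENNReal.tsum_comm]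
  simp_rw [mul_assoc]

lemma tsum_le_of_support {β : Type} (p : PMF β) {f : β → ℝ≥0∞} {b : ℝ≥0∞}
    (h : ∀ x ∈ p.support, f x ≤ b) : ∑' x, p x * f x ≤ b := by
  calc ∑' x, p x * f x ≤ ∑' x, p x * b := by
        refine ENNReal.tsum_le_tsum fun x => ?_
        by_cases hx : p x = 0
        · simp [hx]
        · gcongr; exact h x hx
    _ = b := by rw [ENNReal.tsum_mul_right, p.tsum_coe, one_mul]

lemma expect_mono_support (p : PMF State) {f g : State → ℝ≥0∞}
    (h : ∀ s ∈ p.support, f s ≤ g s) : expect p f ≤ expect p g := by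
  refine ENNReal.tsum_le_tsum fun x => ?_
  by_cases hx : p x = 0
  · simp [hx]
  · gcongr; exact h x hx

variable {G φ M}

lemma wp_mono {c : Cmd} {P Q : State → Prop} {s : State} (h : wp G φ M c P s)
    (hPQ : ∀ t, P t → Q t) : wp G φ M c Q s := fun t ht => hPQ t (h t ht)

lemma wp_skip {Q : State → Prop} {s : State} : wp G φ M .skip Q s ↔ Q (s.tick 1) := by
  simp [wp, Cmd.exec]

lemma wp_set {r : ℕ} {e : Expr} {Q : State → Prop} {s : State} :
    wp G φ M (.set r e) Q s ↔ Q ((s.setReg r (e.eval G M s)).tick (e.cost + 1)) := by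
  simp [wp, Cmd.exec]

lemma wp_write {a : ℕ} {e f : Expr} {Q : State → Prop} {s : State} :
    wp G φ M (.write a e f) Q s ↔
      Q ((s.setMem a (e.eval G M s) (f.eval G M s)).tick (e.cost + f.cost + 1)) := by
  simp [wp, Cmd.exec]

lemma wp_seq {c d : Cmd} {Q : State → Prop} {s : State} :
    wp G φ M (.seq c d) Q s ↔ wp G φ M c (wp G φ M d Q) s := by
  simp only [wp, Cmd.exec, PMF.support_bind, Set.mem_iUnion]
  exact ⟨fun h t ht u hu => h u ⟨t, ht, hu⟩, fun h u ⟨t, ht, hu⟩ => h t ht u hu⟩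

lemma wp_ite {t : Test} {c d : Cmd} {Q : State → Prop} {s : State} :
    wp G φ M (.ite t c d) Q s ↔
      (t.holds G φ M s → wp G φ M c Q (s.tick (t.cost + 1))) ∧
      (¬ t.holds G φ M s → wp G φ M d Q (s.tick (t.cost + 1))) := by
  by_cases h : t.holds G φ M s <;> simp [wp, Cmd.exec, h]

lemma mem_support_uniformBelow {k x : ℕ} (hk : 0 < k) (hx : x ∈ (uniformBelow k).support) :
    x < k := by
  cases k with
  | zero => omega
  | succ k =>
    simp only [uniformBelow, PMF.support_map, Set.mem_image] at hx
    obtain ⟨y, -, rfl⟩ := hx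
    exact y.2

lemma wp_rand {r : ℕ} {e : Expr} {Q : State → Prop} {s : State} (h0 : 0 < e.eval G M s)
    (h : ∀ x < e.eval G M s, Q ((s.setReg r x).tick (e.cost + 1))) :
    wp G φ M (.rand r e) Q s := by
  intro t ht
  simp only [Cmd.exec, PMF.support_map, Set.mem_image] at ht
  obtain ⟨x, hx, rfl⟩ := ht
  exact h x (mem_support_uniformBelow h0 hx)

lemma wp_loop (I : ℕ → State → Prop) {r : ℕ} {e : Expr} {c : Cmd} {Q : State → Prop} {s : State}
    (h0 : I 0 (s.tick (e.cost + 1)))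
    (hstep : ∀ k < e.eval G M s, ∀ t, I k t → wp G φ M c (I (k + 1)) ((t.setReg r k).tick 1))
    (hend : ∀ t, I (e.eval G M s) t → Q t) : wp G φ M (.loop r e c) Q s := by
  have key : ∀ k ≤ e.eval G M s, ∀ t ∈ (rounds (fun k s' => c.exec G φ M ((s'.setReg r k).tick 1)) k
      (s.tick (e.cost + 1))).support, I k t := by
    intro k
    induction k with
    | zero =>
      intro _ t ht
      simp only [rounds, PMF.support_pure, Set.mem_singleton_iff] at ht
      rw [ht]; exact h0
    | succ k ih =>
      intro hk t ht
      simp only [rounds, PMF.support_bind, Set.mem_iUnion] at ht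
      obtain ⟨u, hu, ht⟩ := ht
      exact hstep k hk u (ih (by omega) u hu) t ht
  intro t ht
  exact hend t (key _ le_rfl t ht)

lemma expect_le_of_wp {c : Cmd} {Q : State → Prop} {f : State → ℝ≥0∞} {b : ℝ≥0∞} {s : State}
    (h : wp G φ M c Q s) (hf : ∀ t, Q t → f t ≤ b) : expect (c.exec G φ M s) f ≤ b :=
  tsum_le_of_support _ fun t ht => hf t (h t ht)

lemma expect_seq_le_of_wp {c d : Cmd} {Q : State → Prop} {f : State → ℝ≥0∞} {b : ℝ≥0∞}
    {s : State} (h : wp G φ M c Q s) (hf : ∀ t, Q t → expect (d.exec G φ M t) f ≤ b) :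
    expect ((Cmd.seq c d).exec G φ M s) f ≤ b := by
  rw [Cmd.exec, expect_bind]
  exact tsum_le_of_support _ fun t ht => hf t (h t ht)

lemma expect_ite_le {t : Test} {c d : Cmd} {f : State → ℝ≥0∞} {b : ℝ≥0∞} {s : State}
    (h1 : t.holds G φ M s → expect (c.exec G φ M (s.tick (t.cost + 1))) f ≤ b)
    (h2 : ¬ t.holds G φ M s → expect (d.exec G φ M (s.tick (t.cost + 1))) f ≤ b) :
    expect ((Cmd.ite t c d).exec G φ M s) f ≤ b := by
  by_cases h : t.holds G φ M s
  · simpa [Cmd.exec, h] using h1 h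
  · simpa [Cmd.exec, h] using h2 h

lemma tsum_uniformBelow {k : ℕ} (hk : 0 < k) (f : ℕ → ℝ≥0∞) :
    ∑' x, uniformBelow k x * f x = (∑ x ∈ Finset.range k, f x) / k := by
  cases k with
  | zero => omega
  | succ k =>
    have h : ∀ x, uniformBelow (k + 1) x = if x < k + 1 then ((k + 1 : ℕ) : ℝ≥0∞)⁻¹ else 0 := by
      intro x
      simp only [uniformBelow, PMF.map_apply, PMF.uniformOfFintype_apply, Fintype.card_fin]
      rw [tsum_fintype]
      split_ifs with hx
      · rw [Finset.sum_eq_single (⟨x, hx⟩ : Fin (k + 1))]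
        · simp
        · intro b _ hb
          rw [if_neg]
          intro e; apply hb; ext; exact e.symm
        · simp
      · refine Finset.sum_eq_zero fun b _ => ?_
        rw [if_neg]
        have := b.2
        omega
    rw [tsum_eq_sum (s := Finset.range (k + 1))]
    · rw [div_eq_mul_inv, Finset.sum_mul]
      refine Finset.sum_congr rfl fun x hx => ?_
      rw [h, if_pos (Finset.mem_range.1 hx), mul_comm]
    · intro x hx
      rw [h, if_neg (by simpa using hx), zero_mul]

lemma expect_rand_seq_le {r : ℕ} {e : Expr} {d : Cmd} {f : State → ℝ≥0∞} {b : ℕ → ℝ≥0∞}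
    {s : State} (h0 : 0 < e.eval G M s)
    (h : ∀ x < e.eval G M s,
      expect (d.exec G φ M ((s.setReg r x).tick (e.cost + 1))) f ≤ b x) :
    expect ((Cmd.seq (.rand r e) d).exec G φ M s) f ≤
      (∑ x ∈ Finset.range (e.eval G M s), b x) / (e.eval G M s : ℕ) := by
  rw [Cmd.exec, Cmd.exec, PMF.bind_map, expect_bind, tsum_uniformBelow h0]
  gcongr with x hx
  exact h x (Finset.mem_range.1 hx)

/-- The supermartingale rule: `f k` need not increase in expectation only on the states allowed by
the sure invariant `I k`. -/
lemma expect_loop_le (I : ℕ → State → Prop) (f : ℕ → State → ℝ≥0∞) {r : ℕ} {e : Expr} {c : Cmd}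
    {s : State} (h0 : I 0 (s.tick (e.cost + 1)))
    (hstep : ∀ k < e.eval G M s, ∀ t, I k t → wp G φ M c (I (k + 1)) ((t.setReg r k).tick 1))
    (hf : ∀ k < e.eval G M s, ∀ t, I k t →
      expect (c.exec G φ M ((t.setReg r k).tick 1)) (f (k + 1)) ≤ f k t) :
    expect ((Cmd.loop r e c).exec G φ M s) (f (e.eval G M s)) ≤ f 0 (s.tick (e.cost + 1)) := by
  have key : ∀ k ≤ e.eval G M s,
      (∀ t ∈ (rounds (fun k s' => c.exec G φ M ((s'.setReg r k).tick 1)) k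
        (s.tick (e.cost + 1))).support, I k t) ∧
      expect (rounds (fun k s' => c.exec G φ M ((s'.setReg r k).tick 1)) k
        (s.tick (e.cost + 1))) (f k) ≤ f 0 (s.tick (e.cost + 1)) := by
    intro k
    induction k with
    | zero =>
      intro _
      refine ⟨fun t ht => ?_, by rw [rounds, expect_pure]⟩
      simp only [rounds, PMF.support_pure, Set.mem_singleton_iff] at ht
      rw [ht]; exact h0
    | succ k ih =>
      intro hk
      obtain ⟨ih1, ih2⟩ := ih (by omega)
      constructor
      · intro t ht
        simp only [rounds, PMF.support_bind, Set.mem_iUnion] at ht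
        obtain ⟨u, hu, ht⟩ := ht
        exact hstep k hk u (ih1 u hu) t ht
      · rw [rounds, expect_bind]
        exact (expect_mono_support _ fun t ht => hf k hk t (ih1 t ht)).trans ih2
  exact (key _ le_rfl).2

end Logic

end RAM

/-! ### Vertex sets stored as lists -/

/-- The first `k` values of `f` list the elements of `S` without repetition. -/
structure Listed {n : ℕ} (f : ℕ → ℕ) (k : ℕ) (S : Finset (Fin n)) : Prop where
  lt : ∀ t < k, f t < n
  inj : ∀ t < k, ∀ t' < k, f t = f t' → t = t'
  mem : ∀ v : Fin n, v ∈ S ↔ ∃ t < k, f t = v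

namespace Listed

variable {n : ℕ} {f : ℕ → ℕ} {k : ℕ} {S : Finset (Fin n)}

lemma empty : Listed f 0 (∅ : Finset (Fin n)) :=
  ⟨by simp, by simp, by simp⟩

lemma snoc (h : Listed f k S) {v : Fin n} (hv : v ∉ S) :
    Listed (Function.update f k v) (k + 1) (insert v S) := by
  have hne : ∀ t < k, f t ≠ v := fun t ht e => hv ((h.mem v).2 ⟨t, ht, e⟩)
  have hup : ∀ t < k, Function.update f k (v : ℕ) t = f t := fun t ht =>
    Function.update_of_ne ht.ne _ _
  have hk : Function.update f k (v : ℕ) k = v := Function.update_self _ _ _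
  refine ⟨fun t ht => ?_, fun t ht t' ht' e => ?_, fun u => ?_⟩
  · rcases Nat.lt_succ_iff_lt_or_eq.1 ht with h1 | rfl
    · rw [hup t h1]; exact h.lt t h1
    · rw [hk]; exact v.2
  · rcases Nat.lt_succ_iff_lt_or_eq.1 ht with h1 | rfl <;>
      rcases Nat.lt_succ_iff_lt_or_eq.1 ht' with h2 | rfl
    · rw [hup t h1, hup t' h2] at e; exact h.inj t h1 t' h2 e
    · rw [hup t h1, hk] at e; exact absurd e (hne t h1)
    · rw [hup t' h2, hk] at e; exact absurd e.symm (hne t' h2)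
    · rfl
  · rw [Finset.mem_insert, h.mem]
    constructor
    · rintro (rfl | ⟨t, ht, e⟩)
      · exact ⟨k, by omega, hk⟩
      · exact ⟨t, by omega, by rw [hup t ht, e]⟩
    · rintro ⟨t, ht, e⟩
      rcases Nat.lt_succ_iff_lt_or_eq.1 ht with h1 | rfl
      · exact Or.inr ⟨t, h1, by rw [← e, hup t h1]⟩
      · rw [hk] at e; exact Or.inl (Fin.ext e.symm)

lemma unique (h : Listed f k S) {T : Finset (Fin n)} (h' : Listed f k T) : S = T := by
  ext v; rw [h.mem, h'.mem]

/-- Advances a loop invariant that speaks of the set `T` of entries already processed. -/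
lemma extend (h : Listed f k S) {t : ℕ} {T : Finset (Fin n)} (h' : Listed f t T) (ht : t < k)
    {u : Fin n} (hu : f t = u) : u ∈ S ∧ u ∉ T ∧ Listed f (t + 1) (insert u T) := by
  have hT : u ∉ T := fun hm => by
    obtain ⟨x, hx, e⟩ := (h'.mem u).1 hm
    have := h.inj x (by omega) t ht (e.trans hu.symm)
    omega
  refine ⟨(h.mem u).2 ⟨t, ht, hu⟩, hT, ?_⟩
  have := h'.snoc hT
  rwa [← hu, Function.update_eq_self] at this

lemma subset (h : Listed f k S) {t : ℕ} {T : Finset (Fin n)} (h' : Listed f t T) (ht : t ≤ k) :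
    T ⊆ S := fun v hv => by
  obtain ⟨x, hx, e⟩ := (h'.mem v).1 hv
  exact (h.mem v).2 ⟨x, by omega, e⟩

lemma card_eq (h : Listed f k S) : S.card = k := by
  symm
  have := Finset.card_bij (s := Finset.range k) (t := S)
    (fun t ht => (⟨f t, h.lt t (Finset.mem_range.1 ht)⟩ : Fin n))
    (fun t ht => (h.mem _).2 ⟨t, Finset.mem_range.1 ht, rfl⟩)
    (fun t ht t' ht' e => h.inj t (Finset.mem_range.1 ht) t' (Finset.mem_range.1 ht')
      (congrArg Fin.val e))
    (fun v hv => by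
      obtain ⟨t, ht, e⟩ := (h.mem v).1 hv
      exact ⟨t, Finset.mem_range.2 ht, Fin.ext e⟩)
  simpa using this

lemma le (h : Listed f k S) : k ≤ n := by
  rw [← h.card_eq]; simpa using Finset.card_le_univ S

lemma pos_iff (h : Listed f k S) : 0 < k ↔ S.Nonempty := by
  rw [← h.card_eq, Finset.card_pos]

lemma congr {g : ℕ → ℕ} {l : ℕ} (h : Listed f k S) (hf : g = f) (hk : l = k) : Listed g l S := by
  rw [hf, hk]; exact h

end Listed

/-! ### The program -/

namespace RAM

/-- Add register `21` to the score of the vertex in register `20`, and append this vertex to the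
list of candidates in array `2` if its score was zero. -/
def addScore : Cmd :=
  .seq (.set 22 (.add (.reg 12) (.reg 20))) <|
  .seq (.ite (.lt (.lit 0) (.read 1 (.reg 22))) .skip
    (.seq (.write 2 (.reg 13) (.reg 20)) (.set 13 (.add (.reg 13) (.lit 1))))) <|
  .write 1 (.reg 22) (.add (.read 1 (.reg 22)) (.reg 21))

/-- Add the neighbours of the vertex in register `15` to the scores. -/
def nbrLoop : Cmd := .loop 17 (.reg 16) (.seq (.set 20 (.nbr (.reg 15) (.reg 17))) addScore)

/-- Add the contributions of the vertices listed in array `0` to the scores. -/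
def scoreLoop : Cmd :=
  .loop 14 (.reg 10) <|
    .seq (.set 15 (.read 0 (.reg 14))) <|
    .seq (.set 16 (.deg (.reg 15))) <|
    .seq (.set 20 (.reg 15)) <|
    .seq (.set 21 (.reg 16)) <|
    .seq addScore <|
    .seq (.set 21 (.lit 1)) nbrLoop

/-- Compute the scores of all vertices with respect to the set listed in array `0`. -/
def scorePhase : Cmd :=
  -- Register `9` is the total weight processed so far. It grows by at least `1` per step, so each
  -- step has its own block of `n` zero cells and nothing need be erased.
  .seq (.set 12 (.mul (.reg 9) (.reg 1))) <|
  .seq (.set 9 (.add (.reg 9) (.reg 11))) <|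
  .seq (.set 13 (.lit 0)) scoreLoop

/-- Sum the scores of the elements of the set listed in array `0`. -/
def sumPhase : Cmd :=
  .seq (.set 18 (.lit 0)) <|
  .loop 14 (.reg 10) (.set 18 (.add (.reg 18) (.read 1 (.add (.reg 12) (.read 0 (.reg 14))))))

/-- List in array `0` the candidates that pass the threshold in register `19`. -/
def selectPhase : Cmd :=
  .seq (.set 10 (.lit 0)) <|
  .seq (.set 11 (.lit 0)) <|
  .loop 14 (.reg 13) <|
    .seq (.set 15 (.read 2 (.reg 14))) <|
    .seq (.set 16 (.mul (.lit 2) (.deg (.reg 15)))) <|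
    .ite (.lt (.mul (.reg 7) (.read 1 (.add (.reg 12) (.reg 15))))
        (.mul (.reg 16) (.add (.reg 19) (.lit 1)))) .skip <|
      .seq (.write 0 (.reg 10) (.reg 15)) <|
      .seq (.set 10 (.add (.reg 10) (.lit 1))) <|
      .set 11 (.add (.reg 11) (.reg 16))

/-- One step of the evolving set process, with output of a set of small conductance. -/
def evolveStep : Cmd :=
  .seq scorePhase <|
  .seq sumPhase <|
  -- Weight minus the sum of the inner scores is the cut.
  .ite (.ltPhi (.sub (.reg 11) (.reg 18)) (.reg 11)) (.set 0 (.reg 10))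
    (.seq (.rand 19 (.reg 7)) selectPhase)

/-- A step of the evolving set process, unless the run or the whole computation is finished. -/
def guardedStep : Cmd :=
  -- The guards ask in turn whether a set was found, the budget is exhausted, the set is too heavy,
  -- or the set is still alive.
  .ite (.lt (.lit 0) (.reg 0)) .skip <|
  .ite (.lt (.reg 8) (.reg 9)) .skip <|
  .ite (.lt (.reg 5) (.reg 11)) .skip <|
  .ite (.lt (.lit 0) (.reg 10)) evolveStep .skip

/-- One run of the evolving set process from the start vertex. -/
def evolveRun : Cmd :=
  .ite (.lt (.lit 0) (.reg 0)) .skip <|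
  .seq (.write 0 (.lit 0) (.reg 3)) <|
  .seq (.set 10 (.lit 1)) <|
  .seq (.set 11 (.reg 6)) <|
  .loop 24 (.reg 4) guardedStep

/-- The loop over all runs. -/
def mainLoop : Cmd :=
  .loop 23 (.add (.div (.mul (.reg 4) (.reg 5)) (.reg 6)) (.lit 1)) evolveRun

/-- The algorithm. -/
def cutOrBound : Cmd :=
  .seq (.set 6 (.mul (.lit 2) (.deg (.reg 3)))) <|
  .ite (.lt (.reg 5) (.reg 6)) .skip <|
  -- Register `7` is the number `W = 4mℓ` of thresholds, register `8` the budget `ℓ³⌈1/α⌉`.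
  .seq (.set 7 (.mul (.lit 4) (.mul (.reg 2) (.reg 4)))) <|
  .seq (.set 8 (.mul (.reg 4) (.mul (.reg 4) (.mul (.reg 4) (.reg 5))))) <|
  mainLoop

/-! ### Correctness and cost of the phases of one step -/

/-- Array `1` holds the scores `sc` in the region from `b`, array `2` lists the vertices with
positive score. -/
structure Scores {n : ℕ} (b : ℕ) (sc : Fin n → ℕ) (s : State) : Prop where
  base : s.reg 12 = b
  cell : ∀ v : Fin n, s.mem 1 (b + v) = sc v
  zero : ∀ x, b + n ≤ x → s.mem 1 x = 0
  cand : Listed (s.mem 2) (s.reg 13) (Finset.univ.filter fun v => 0 < sc v)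

variable {n : ℕ} {G : Multigraph n} {φ : ℝ} {M : ℕ}

lemma Scores.congr {b : ℕ} {sc : Fin n → ℕ} {s t : State} (h : Scores b sc s)
    (h12 : t.reg 12 = s.reg 12) (h13 : t.reg 13 = s.reg 13) (h1 : t.mem 1 = s.mem 1)
    (h2 : t.mem 2 = s.mem 2) : Scores b sc t :=
  ⟨h12.trans h.base, by rw [h1]; exact h.cell, by rw [h1]; exact h.zero, h.cand.congr h2 h13⟩

lemma Scores.bump {b : ℕ} {sc : Fin n → ℕ} {s t : State} (h : Scores b sc s) {v : Fin n} {a : ℕ}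
    (ha : 0 < a) (h12 : t.reg 12 = b)
    (h1 : t.mem 1 = Function.update (s.mem 1) (b + v) (sc v + a))
    (h2 : if 0 < sc v then t.mem 2 = s.mem 2 ∧ t.reg 13 = s.reg 13 else
      t.mem 2 = Function.update (s.mem 2) (s.reg 13) v ∧ t.reg 13 = s.reg 13 + 1) :
    Scores b (sc + Pi.single v a) t := by
  refine ⟨h12, fun u => ?_, fun x hx => ?_, ?_⟩
  · rw [h1]
    by_cases e : u = v
    · subst e; simp
    · have : b + (u : ℕ) ≠ b + v := fun h => e (Fin.ext (by omega))
      rw [Function.update_of_ne this, h.cell]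
      simp [e]
  · have := v.2
    rw [h1, Function.update_of_ne (by omega), h.zero x hx]
  · split_ifs at h2 with hv
    · have : (Finset.univ.filter fun u => 0 < (sc + Pi.single v a : Fin n → ℕ) u) =
          Finset.univ.filter fun u => 0 < sc u := by
        ext u
        by_cases e : u = v
        · subst e; simp [hv]
        · simp [e]
      rw [this]
      exact h.cand.congr h2.1 h2.2
    · have : (Finset.univ.filter fun u => 0 < (sc + Pi.single v a : Fin n → ℕ) u) =
          insert v (Finset.univ.filter fun u => 0 < sc u) := by
        ext u
        by_cases e : u = v
        · subst e; simp [ha]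
        · simp [e]
      rw [this]
      exact (h.cand.snoc (by simpa using hv)).congr h2.1 h2.2

lemma wp_addScore {s : State} {b : ℕ} {sc : Fin n → ℕ} (hs : Scores b sc s) (v : Fin n)
    (hv : s.reg 20 = v) (ha : 0 < s.reg 21) (hb : b + n ≤ M) (hn : n < M)
    (hsum : sc v + s.reg 21 < M) :
    wp G φ M addScore (fun t => Scores b (sc + Pi.single v (s.reg 21)) t ∧ t.mem 0 = s.mem 0 ∧
      (∀ r, r ≠ 13 → r ≠ 22 → t.reg r = s.reg r) ∧ t.clock ≤ s.clock + 25) s := by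
  have hv2 := v.2
  have h1 : 1 % M = 1 := Nat.mod_eq_of_lt (by omega)
  have h2 : (b + (v : ℕ)) % M = b + v := Nat.mod_eq_of_lt (by omega)
  have hk := hs.cand.le
  simp only [addScore, wp_seq, wp_set, wp_ite, wp_skip, wp_write, Expr.eval, Test.holds,
    Expr.cost, Test.cost, State.tick, State.setReg, State.setMem, Function.update_apply,
    Nat.zero_mod, hs.base, hv, h1, h2]
  simp only [Nat.reduceEqDiff, if_true, if_false, hs.cell]
  have h3 : (sc v + s.reg 21) % M = sc v + s.reg 21 := Nat.mod_eq_of_lt hsum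
  constructor
  · intro hpos
    refine ⟨hs.bump ha ?_ ?_ ?_, ?_, ?_, ?_⟩
    · simp [hs.base]
    · simp [h3]
    · simp [hpos]
    · simp
    · intro r _ hr; simp [hr]
    · simp
  · intro hpos
    -- The vertex is not yet listed, so the list of candidates is not full.
    have hk' : s.reg 13 < n := by
      rw [← hs.cand.card_eq]
      refine (Finset.card_lt_univ_of_notMem (x := v) (by simpa using hpos)).trans_eq (by simp)
    have h4 : (s.reg 13 + 1) % M = s.reg 13 + 1 := Nat.mod_eq_of_lt (by omega)
    refine ⟨hs.bump ha ?_ ?_ ?_, ?_, ?_, ?_⟩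
    · simp [hs.base]
    · simp [h3]
    · simp [hpos, h4]
    · simp
    · intro r hr1 hr; simp [hr, hr1]
    · simp


lemma degQuery_val (u : Fin n) : degQuery G u = G.deg u := by simp [degQuery]

lemma nbrQuery_val (u : Fin n) {a : ℕ} (ha : a < G.deg u) :
    nbrQuery G u a = ((G.nbrs u)[a]'ha : Fin n) := by
  have : (G.nbrs u)[a]? = some ((G.nbrs u)[a]'ha) := List.getElem?_eq_getElem ha
  simp [nbrQuery, this]

lemma count_take_succ (l : List (Fin n)) {a : ℕ} (ha : a < l.length) :
    (fun v => (l.take (a + 1)).count v) =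
      (fun v => (l.take a).count v) + Pi.single l[a] 1 := by
  funext v
  rw [List.take_add_one, List.getElem?_eq_getElem ha, Pi.add_apply, List.count_append,
    Option.toList_some, List.count_singleton, Pi.single_apply]
  congr 1
  by_cases e : v = l[a]
  · simp [e]
  · rw [if_neg e, if_neg]
    simpa using Ne.symm e

lemma Scores.setReg {b : ℕ} {sc : Fin n → ℕ} {s : State} (h : Scores b sc s) {r : ℕ} (x k : ℕ)
    (h12 : 12 ≠ r) (h13 : 13 ≠ r) : Scores b sc ((s.setReg r x).tick k) :=
  h.congr (Function.update_of_ne h12 _ _) (Function.update_of_ne h13 _ _) rfl rfl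

lemma wp_nbrLoop {s : State} {b : ℕ} {sc : Fin n → ℕ} (u : Fin n) (hs : Scores b sc s)
    (h15 : s.reg 15 = u) (h16 : s.reg 16 = G.deg u) (h21 : s.reg 21 = 1) (hb : b + n ≤ M)
    (hn : n < M) (hsum : ∀ v, sc v + G.mult u v < M) :
    wp G φ M nbrLoop (fun t => Scores b (sc + G.mult u) t ∧ t.mem 0 = s.mem 0 ∧
      (∀ r, r < 12 ∨ 22 < r ∨ r = 14 → t.reg r = s.reg r) ∧
      t.clock ≤ s.clock + 2 + 30 * G.deg u) s := by
  unfold nbrLoop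
  refine wp_loop (fun a t => Scores b (sc + fun v => ((G.nbrs u).take a).count v) t ∧
      t.mem 0 = s.mem 0 ∧ (∀ r, r ≠ 13 → r ≠ 17 → r ≠ 20 → r ≠ 22 → t.reg r = s.reg r) ∧
      t.clock ≤ s.clock + 2 + 30 * a) ?_ ?_ ?_
  · refine ⟨?_, rfl, fun r _ _ _ _ => rfl, by simp [State.tick, Expr.cost]⟩
    have : (sc + fun v => ((G.nbrs u).take 0).count v) = sc := by funext v; simp
    rw [this]
    exact ⟨hs.base, hs.cell, hs.zero, hs.cand⟩
  · rintro a ha t ⟨i1, i2, i3, i4⟩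
    simp only [Expr.eval, h16] at ha
    have hlen : a < (G.nbrs u).length := ha
    have e15 : t.reg 15 = u := by rw [i3 15 (by omega) (by omega) (by omega) (by omega), h15]
    have e21 : t.reg 21 = 1 := by rw [i3 21 (by omega) (by omega) (by omega) (by omega), h21]
    have hlt := ((G.nbrs u)[a]).2
    rw [wp_seq, wp_set]
    refine wp_mono (wp_addScore (b := b) (sc := sc + fun v => ((G.nbrs u).take a).count v)
      (Scores.setReg (Scores.setReg i1 _ _ (by decide) (by decide)) _ _ (by decide) (by decide))
      (G.nbrs u)[a] ?_ ?_ hb hn ?_) ?_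
    · simp only [Expr.eval, State.setReg, State.tick, e15, nbrQuery_val u ha,
        Function.update_apply, Nat.reduceEqDiff, if_false, if_true]
      exact Nat.mod_eq_of_lt (hlt.trans hn)
    · simp [State.setReg, State.tick, e21]
    · simp only [State.setReg, State.tick, Function.update_apply, e21]
      have h1 := congrFun (count_take_succ (G.nbrs u) hlen) (G.nbrs u)[a]
      have h2 := List.Sublist.count_le (G.nbrs u)[a] (List.take_sublist (a + 1) (G.nbrs u))
      have h3 := hsum (G.nbrs u)[a]
      simp only [Pi.add_apply, Pi.single_eq_same, Multigraph.mult, Nat.reduceEqDiff,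
        if_false] at h1 h2 h3 ⊢
      omega
    · rintro t' ⟨j1, j2, j3, j4⟩
      simp only [State.setReg, State.tick, Function.update_apply, Nat.reduceEqDiff, if_false, e21,
        Expr.cost] at j1 j2 j3 j4
      refine ⟨?_, j2.trans i2, fun r q1 q2 q3 q4 => ?_, by omega⟩
      · rw [count_take_succ _ hlen, ← add_assoc]; exact j1
      · rw [j3 r q1 q4, if_neg q3, if_neg q2, i3 r q1 q2 q3 q4]
  · rintro t ⟨i1, i2, i3, i4⟩
    simp only [Expr.eval, h16] at i1 i4
    refine ⟨?_, i2, fun r hr => i3 r (by omega) (by omega) (by omega) (by omega), i4⟩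
    have : (fun v => ((G.nbrs u).take (G.deg u)).count v) = G.mult u := by
      funext v; rw [Multigraph.deg, List.take_length]; rfl
    rwa [this] at i1

/-- The work at a vertex is linear in its degree; the constant overhead is absorbed because degrees
are positive. -/
lemma wp_scoreLoop {s : State} {b : ℕ} {S : Finset (Fin n)} (hd : ∀ v, 0 < G.deg v)
    (hs : Scores b (0 : Fin n → ℕ) s) (hl : Listed (s.mem 0) (s.reg 10) S)
    (hb : b + n ≤ M) (hM : 2 * G.totalDeg < M) (hn : n < M) :
    wp G φ M scoreLoop (fun t => Scores b (G.score S) t ∧ t.mem 0 = s.mem 0 ∧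
      (∀ r, r < 12 ∨ 22 < r → t.reg r = s.reg r) ∧
      t.clock ≤ s.clock + 2 + 50 * G.weight S) s := by
  unfold scoreLoop
  refine wp_loop (fun k t => ∃ T : Finset (Fin n), Listed (s.mem 0) k T ∧
      Scores b (G.score T) t ∧ t.mem 0 = s.mem 0 ∧
      (∀ r, r < 12 ∨ 22 < r → t.reg r = s.reg r) ∧
      t.clock ≤ s.clock + 2 + 50 * G.weight T) ?_ ?_ ?_
  · refine ⟨∅, Listed.empty, ?_, rfl, fun r _ => rfl, by simp [State.tick, Expr.cost]⟩
    have : G.score ∅ = 0 := by funext v; simp [Multigraph.score, Multigraph.links]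
    rw [this]
    exact ⟨hs.base, hs.cell, hs.zero, hs.cand⟩
  · rintro k hk t ⟨T, hT, i1, i2, i3, i4⟩
    simp only [Expr.eval] at hk
    obtain ⟨u, hu⟩ : ∃ u : Fin n, s.mem 0 k = u := ⟨⟨_, hl.lt k hk⟩, rfl⟩
    obtain ⟨-, huT, hT'⟩ := hl.extend hT hk hu
    have hdM : G.deg u < M := by have := G.deg_le_totalDeg u; omega
    have hdu := hd u
    have hle : ∀ v, G.score (insert u T) v < M := fun v => by
      have := G.score_le (insert u T) v
      have := G.deg_le_totalDeg v
      omega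
    have hsc : G.score (insert u T) = G.score T + Pi.single u (G.deg u) + G.mult u := by
      funext v
      rw [G.score_insert huT, Pi.add_apply, Pi.add_apply, Pi.single_apply]
    rw [wp_seq, wp_set, wp_seq, wp_set, wp_seq, wp_set, wp_seq, wp_set, wp_seq]
    have r1 : (1 : ℕ) % M = 1 := Nat.mod_eq_of_lt (by omega)
    refine wp_mono (wp_addScore (b := b) (sc := G.score T) ?_ u ?_ ?_
      hb hn ?_) ?_
    · exact ((((i1.setReg _ _ (by decide) (by decide)).setReg _ _ (by decide) (by decide)).setReg
        _ _ (by decide) (by decide)).setReg _ _ (by decide) (by decide)).setReg _ _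
        (by decide) (by decide)
    · simp [Expr.eval, State.setReg, State.tick, i2, hu]
    · simp [Expr.eval, State.setReg, State.tick, i2, hu, degQuery_val, Nat.mod_eq_of_lt hdM, hdu]
    · have := hle u
      rw [hsc] at this
      simp only [Pi.add_apply, Pi.single_eq_same] at this
      simp [Expr.eval, State.setReg, State.tick, i2, hu, degQuery_val, Nat.mod_eq_of_lt hdM]
      omega
    · rintro t' ⟨j1, j2, j3, j4⟩
      simp only [Expr.eval, State.setReg, State.tick, Function.update_apply, Nat.reduceEqDiff,
        if_false, if_true, i2, hu, degQuery_val, Nat.mod_eq_of_lt hdM, Expr.cost] at j1 j2 j3 j4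
      have e15 := j3 15 (by omega) (by omega)
      have e16 := j3 16 (by omega) (by omega)
      simp only [Nat.reduceEqDiff, if_false, if_true] at e15 e16
      rw [wp_seq, wp_set]
      refine wp_mono (wp_nbrLoop (b := b) (sc := G.score T + Pi.single u (G.deg u)) u
        (j1.setReg _ _ (by decide) (by decide)) ?_ ?_ ?_ hb hn ?_) ?_
      · simp [State.setReg, State.tick, e15]
      · simp [State.setReg, State.tick, e16]
      · simp [State.setReg, State.tick, Expr.eval, r1]
      · intro v
        have := hle v
        rw [hsc] at this
        exact this
      · rintro w ⟨l1, l2, l3, l4⟩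
        refine ⟨insert u T, hT', ?_, ?_, ?_, ?_⟩
        · rw [hsc]; exact l1
        · rw [l2]; exact j2
        · intro r hr
          rw [l3 r (by omega)]
          simp only [State.setReg, State.tick, Function.update_apply]
          rw [if_neg (by omega), j3 r (by omega) (by omega), if_neg (by omega), if_neg (by omega),
            if_neg (by omega), if_neg (by omega), if_neg (by omega), i3 r hr]
        · simp only [State.setReg, State.tick, Expr.cost] at l4
          have : G.weight (insert u T) = 2 * G.deg u + G.weight T := by
            rw [Multigraph.weight, Finset.sum_insert huT]; rfl
          omega
  · rintro t ⟨T, hT, i1, i2, i3, i4⟩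
    obtain rfl := hl.unique hT
    exact ⟨i1, i2, i3, i4⟩

lemma wp_scorePhase {s : State} {S : Finset (Fin n)} (hd : ∀ v, 0 < G.deg v) (h1 : s.reg 1 = n)
    (hl : Listed (s.mem 0) (s.reg 10) S) (hw : s.reg 11 = G.weight S)
    (hz : ∀ x, s.reg 9 * n ≤ x → s.mem 1 x = 0) (hb : s.reg 9 * n + n < M)
    (hu : s.reg 9 + G.weight S < M) (hM : 2 * G.totalDeg < M) (hn : n < M) :
    wp G φ M scorePhase (fun t => Scores (s.reg 9 * n) (G.score S) t ∧ t.mem 0 = s.mem 0 ∧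
      t.reg 9 = s.reg 9 + G.weight S ∧
      (∀ r, r < 9 ∨ r = 10 ∨ r = 11 ∨ 22 < r → t.reg r = s.reg r) ∧
      t.clock ≤ s.clock + 20 + 50 * G.weight S) s := by
  have e1 : (s.reg 9 * n) % M = s.reg 9 * n := Nat.mod_eq_of_lt (by omega)
  have e2 : (s.reg 9 + G.weight S) % M = s.reg 9 + G.weight S := Nat.mod_eq_of_lt hu
  rw [scorePhase, wp_seq, wp_set, wp_seq, wp_set, wp_seq, wp_set]
  refine wp_mono (wp_scoreLoop hd (b := s.reg 9 * n) (S := S) ⟨?_, ?_, ?_, ?_⟩ ?_ hb.le hM hn) ?_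
  · simp [Expr.eval, State.setReg, State.tick, h1, e1]
  · intro v; exact hz _ (by omega)
  · intro x hx; exact hz _ (by omega)
  · simpa [Expr.eval, State.setReg, State.tick] using Listed.empty
  · exact hl
  · rintro t ⟨i1, i2, i3, i4⟩
    refine ⟨i1, i2, ?_, ?_, ?_⟩
    · rw [i3 9 (by omega)]
      simp [Expr.eval, State.setReg, State.tick, hw, e2]
    · intro r hr
      rw [i3 r (by omega)]
      simp only [State.setReg, State.tick, Function.update_apply]
      rw [if_neg (by omega), if_neg (by omega), if_neg (by omega)]
    · simp only [State.setReg, State.tick, Expr.cost] at i4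
      omega

lemma wp_sumPhase {s : State} {b : ℕ} {S : Finset (Fin n)} (hs : Scores b (G.score S) s)
    (hl : Listed (s.mem 0) (s.reg 10) S) (hb : b + n ≤ M) (hw : G.weight S < M) :
    wp G φ M sumPhase (fun t => Scores b (G.score S) t ∧ t.mem 0 = s.mem 0 ∧
      t.reg 18 + G.cutSize S = G.weight S ∧
      (∀ r, r < 12 ∨ 22 < r → t.reg r = s.reg r) ∧
      t.clock ≤ s.clock + 4 + 10 * s.reg 10) s := by
  have key : ∀ T ⊆ S, ∑ v ∈ T, G.score S v < M := fun T hT => by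
    have h1 := Finset.sum_le_sum_of_subset (f := G.score S) hT
    have h2 := G.sum_score_add_cutSize S
    omega
  rw [sumPhase, wp_seq, wp_set]
  refine wp_loop (fun k t => ∃ T : Finset (Fin n), Listed (s.mem 0) k T ∧
      Scores b (G.score S) t ∧ t.mem 0 = s.mem 0 ∧ t.reg 18 = ∑ v ∈ T, G.score S v ∧
      (∀ r, r < 12 ∨ 22 < r → t.reg r = s.reg r) ∧
      t.clock ≤ s.clock + 4 + 10 * k) ?_ ?_ ?_
  · refine ⟨∅, Listed.empty, ?_, rfl, ?_, fun r hr => ?_, ?_⟩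
    · exact ⟨hs.base, hs.cell, hs.zero, hs.cand⟩
    · simp [State.setReg, State.tick, Expr.eval]
    · simp only [State.setReg, State.tick, Function.update_apply]
      rw [if_neg (by omega)]
    · simp [State.setReg, State.tick, Expr.cost]
  · rintro k hk t ⟨T, hT, i1, i2, i3, i4, i5⟩
    replace hk : k < s.reg 10 := by simpa [Expr.eval, State.setReg, State.tick] using hk
    obtain ⟨u, hu⟩ : ∃ u : Fin n, s.mem 0 k = u := ⟨⟨_, hl.lt k hk⟩, rfl⟩
    obtain ⟨huS, huT, hT'⟩ := hl.extend hT hk hu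
    have hu2 := u.2
    have e1 : (b + (u : ℕ)) % M = b + u := Nat.mod_eq_of_lt (by omega)
    have hsum := key (insert u T)
      (Finset.insert_subset huS (hl.subset hT hk.le))
    rw [Finset.sum_insert huT] at hsum
    rw [wp_set]
    refine ⟨insert u T, hT', i1.congr ?_ ?_ rfl rfl, i2, ?_, fun r hr => ?_, ?_⟩
    · simp [State.setReg, State.tick]
    · simp [State.setReg, State.tick]
    · simp only [State.setReg, State.tick, Expr.eval, Function.update_apply, Nat.reduceEqDiff,
        if_false, if_true, i3, i2, hu, i1.base, e1, i1.cell]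
      rw [Finset.sum_insert huT, Nat.mod_eq_of_lt (by omega), add_comm]
    · simp only [State.setReg, State.tick, Function.update_apply]
      rw [if_neg (by omega), if_neg (by omega), i4 r hr]
    · simp only [State.setReg, State.tick, Expr.cost]
      omega
  · rintro t ⟨T, hT, i1, i2, i3, i4, i5⟩
    simp only [Expr.eval, State.setReg, State.tick, Function.update_apply, Nat.reduceEqDiff,
        if_false] at hT i5
    obtain rfl := hl.unique hT
    exact ⟨i1, i2, by rw [i3, G.sum_score_add_cutSize], i4, i5⟩

lemma wp_selectPhase {s : State} {b W : ℕ} {S : Finset (Fin n)} (hd : ∀ v, 0 < G.deg v)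
    (hs : Scores b (G.score S) s) (h7 : s.reg 7 = W) (h19 : s.reg 19 < W)
    (hb : b + n ≤ M) (hn : n < M) (hM : 2 * G.totalDeg < M) (hW : W * (2 * G.totalDeg) < M) :
    wp G φ M selectPhase (fun t =>
      Listed (t.mem 0) (t.reg 10) (G.evolve W S (s.reg 19)) ∧
      t.reg 11 = G.weight (G.evolve W S (s.reg 19)) ∧ t.mem 1 = s.mem 1 ∧
      (∀ r, r < 10 ∨ 22 < r → t.reg r = s.reg r) ∧
      t.clock ≤ s.clock + 6 + 40 * s.reg 13) s := by
  set C := Finset.univ.filter fun v => 0 < G.score S v with hC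
  obtain ⟨ρ, hρ⟩ : ∃ ρ, s.reg 19 = ρ := ⟨_, rfl⟩
  rw [hρ] at h19 ⊢
  set E := G.evolve W S ρ with hE
  -- The smallest threshold is positive, so vertices of score zero never enter and scanning the
  -- candidates suffices.
  have hEC : E ⊆ C := by
    intro v hv
    simp only [hE, hC, Multigraph.evolve, Finset.mem_filter, Finset.mem_univ, true_and] at hv ⊢
    rcases Nat.eq_zero_or_pos (G.score S v) with h | h
    · rw [h] at hv
      have h1 := hd v
      have : 0 < 2 * G.deg v * (ρ + 1) := by positivity
      omega
    · exact h
  rw [selectPhase, wp_seq, wp_set, wp_seq, wp_set]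
  refine wp_loop (fun k t => ∃ T : Finset (Fin n), Listed (s.mem 2) k T ∧
      Listed (t.mem 0) (t.reg 10) (T ∩ E) ∧ t.reg 11 = G.weight (T ∩ E) ∧ t.mem 1 = s.mem 1 ∧
      t.mem 2 = s.mem 2 ∧
      (∀ r, r < 10 ∨ r = 12 ∨ r = 19 ∨ 22 < r → t.reg r = s.reg r) ∧
      t.clock ≤ s.clock + 6 + 40 * k) ?_ ?_ ?_
  · refine ⟨∅, Listed.empty, ?_, ?_, rfl, rfl, fun r hr => ?_, ?_⟩
    · rw [Finset.empty_inter]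
      simpa [Expr.eval, State.setReg, State.tick] using Listed.empty
    · simp [Expr.eval, State.setReg, State.tick, Multigraph.weight]
    · simp only [State.setReg, State.tick, Function.update_apply]
      rw [if_neg (by omega), if_neg (by omega)]
    · simp [State.setReg, State.tick, Expr.cost]
  · rintro k hk t ⟨T, hT, i1, i2, i3, i4, i5, i6⟩
    replace hk : k < s.reg 13 := by simpa [Expr.eval, State.setReg, State.tick] using hk
    obtain ⟨u, hu⟩ : ∃ u : Fin n, s.mem 2 k = u := ⟨⟨_, hs.cand.lt k hk⟩, rfl⟩
    obtain ⟨huS, huT, hT'⟩ := hs.cand.extend hT hk hu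
    have hu2 := u.2
    have hdu := G.deg_le_totalDeg u
    have e1 : (b + (u : ℕ)) % M = b + u := Nat.mod_eq_of_lt (by omega)
    have e2 : G.deg u % M = G.deg u := Nat.mod_eq_of_lt (by omega)
    have e3 : 2 % M = 2 := Nat.mod_eq_of_lt (by have := hd u; omega)
    have e4 : 2 * G.deg u % M = 2 * G.deg u := Nat.mod_eq_of_lt (by omega)
    have e5 : W * G.score S u % M = W * G.score S u := Nat.mod_eq_of_lt <|
      lt_of_le_of_lt (Nat.mul_le_mul_left W ((G.score_le S u).trans (by omega))) hW
    have e6 : 1 % M = 1 := Nat.mod_eq_of_lt (by have := hd u; omega)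
    have hWM : W < M := lt_of_le_of_lt (Nat.le_mul_of_pos_right W (by have := hd u; omega)) hW
    have e7 : (ρ + 1) % M = ρ + 1 := Nat.mod_eq_of_lt (by omega)
    have e8 : 2 * G.deg u * (ρ + 1) % M = 2 * G.deg u * (ρ + 1) := Nat.mod_eq_of_lt <| by
      refine lt_of_le_of_lt ?_ hW
      rw [mul_comm]
      exact Nat.mul_le_mul h19 (by omega)
    have hmem : u ∈ E ↔ ¬ W * G.score S u < 2 * G.deg u * (ρ + 1) := by
      simp [hE, Multigraph.evolve]
    rw [wp_seq, wp_set, wp_seq, wp_set, wp_ite]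
    simp only [Test.holds, Expr.eval, State.setReg, State.tick, Function.update_apply,
      Nat.reduceEqDiff, if_false, if_true, i4, hu, i3, i5 12 (by omega), i5 7 (by omega),
      i5 19 (by omega), hs.base, hs.cell, e1, h7, e5, degQuery_val, e2, e3, e4, e6, hρ, e7, e8]
    constructor
    · intro hlt
      have hnot : u ∉ E := fun h => (hmem.1 h) hlt
      rw [wp_skip]
      refine ⟨insert u T, hT', ?_, ?_, i3, i4, fun r hr => ?_, ?_⟩
      · rw [Finset.insert_inter_of_notMem hnot]
        exact i1.congr rfl (by simp [State.tick])
      · rw [Finset.insert_inter_of_notMem hnot]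
        simpa [State.tick] using i2
      · simp only [State.tick]
        rw [Function.update_of_ne (by omega), Function.update_of_ne (by omega),
          Function.update_of_ne (by omega), i5 r hr]
      · simp only [State.tick, Expr.cost, Test.cost]
        omega
    · intro hlt
      have hin : u ∈ E := hmem.2 hlt
      have huTE : u ∉ T ∩ E := fun h => huT (Finset.mem_inter.1 h).1
      have hwt : G.weight (insert u (T ∩ E)) = 2 * G.deg u + G.weight (T ∩ E) := by
        rw [Multigraph.weight, Finset.sum_insert huTE]; rfl
      have hwle := G.weight_le (insert u (T ∩ E))
      have hlist := i1.snoc huTE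
      have hk10 := hlist.le
      have e9 : (t.reg 10 + 1) % M = t.reg 10 + 1 := Nat.mod_eq_of_lt (by omega)
      have e10 : (G.weight (T ∩ E) + 2 * G.deg u) % M = G.weight (T ∩ E) + 2 * G.deg u :=
        Nat.mod_eq_of_lt (by omega)
      rw [wp_seq, wp_write, wp_seq, wp_set, wp_set]
      simp only [Expr.eval, State.setReg, State.setMem, State.tick, Function.update_apply,
        Nat.reduceEqDiff, if_false, if_true, Expr.cost, Test.cost, e6, e9, i2, e10]
      refine ⟨insert u T, hT', ?_, ?_, ?_, ?_, fun r hr => ?_, ?_⟩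
      · rw [Finset.insert_inter_of_mem hin]
        simpa using hlist
      · rw [Finset.insert_inter_of_mem hin, hwt]
        omega
      · simpa using i3
      · simpa using i4
      · rw [if_neg (by omega), if_neg (by omega), if_neg (by omega), if_neg (by omega),
          if_neg (by omega), i5 r hr]
      · omega
  · rintro t ⟨T, hT, i1, i2, i3, i4, i5, i6⟩
    simp only [Expr.eval, State.setReg, State.tick, Function.update_apply, Nat.reduceEqDiff,
        if_false] at hT i6
    obtain rfl := hs.cand.unique hT
    rw [Finset.inter_eq_right.2 hEC] at i1 i2
    exact ⟨i1, i2, i3, fun r hr => i5 r (by omega), i6⟩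

end RAM

namespace Multigraph
variable {n : ℕ} (G : Multigraph n)

lemma sum_score (S : Finset (Fin n)) : ∑ v, G.score S v = G.weight S := by
  rw [← G.sum_score_add_cutSize S, ← Finset.sum_add_sum_compl S, ← G.sum_compl_links]
  congr 1
  exact Finset.sum_congr rfl fun v hv => by simp [score, Finset.mem_compl.1 hv]

lemma card_le_weight (hd : ∀ v, 0 < G.deg v) (S : Finset (Fin n)) : S.card ≤ G.weight S := by
  rw [Finset.card_eq_sum_ones, weight]
  exact Finset.sum_le_sum fun v _ => by have := hd v; omega

/-- Bounds the number of candidates, hence the cost of the selection, by the weight of the old set.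
-/
lemma card_score_pos_le (S : Finset (Fin n)) :
    (Finset.univ.filter fun v => 0 < G.score S v).card ≤ G.weight S := by
  rw [← G.sum_score, Finset.card_filter]
  refine Finset.sum_le_sum fun v _ => ?_
  split_ifs <;> omega

end Multigraph

/-! ### Invariants and one step of the process -/

namespace RAM

/-- The numbers occurring in a computation, and the bounds that prevent overflow. -/
structure Setup {n : ℕ} (G : Multigraph n) (M B W lim : ℕ) : Prop where
  deg_pos : ∀ v, 0 < G.deg v
  n_lt : n < M
  deg_lt : 2 * G.totalDeg < M
  prod_lt : W * (2 * G.totalDeg) < M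
  index_lt : lim * n + n < M
  lim_lt : lim + B < M
  W_pos : 0 < W
  lim_pos : 0 < lim

/-- The part of the state that holds between any two steps. -/
structure Inv {n : ℕ} (G : Multigraph n) (φ : ℝ) (i : Fin n) (l B W lim : ℕ) (t : State) :
    Prop where
  reg1 : t.reg 1 = n
  reg3 : t.reg 3 = i
  reg4 : t.reg 4 = l
  reg5 : t.reg 5 = B
  reg6 : t.reg 6 = G.weight {i}
  reg7 : t.reg 7 = W
  reg8 : t.reg 8 = lim
  fresh : ∀ x, t.reg 9 * n ≤ x → t.mem 1 x = 0
  used : t.reg 9 ≤ lim + B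
  out : 0 < t.reg 0 → ∃ S : Finset (Fin n), Listed (t.mem 0) (t.reg 0) S ∧ G.weight S ≤ B ∧
    (G.cutSize S : ℝ) < φ * G.weight S

/-- Array `0` and the registers `10` and `11` hold the set `S` and its weight. -/
def Current {n : ℕ} (G : Multigraph n) (S : Finset (Fin n)) (t : State) : Prop :=
  Listed (t.mem 0) (t.reg 10) S ∧ t.reg 11 = G.weight S

/-- The situation after the scores have been computed. -/
structure Scored {n : ℕ} (G : Multigraph n) (S : Finset (Fin n)) (t u : State) : Prop where
  scores : Scores (t.reg 9 * n) (G.score S) u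
  mem0 : u.mem 0 = t.mem 0
  cut : u.reg 18 + G.cutSize S = G.weight S
  used : u.reg 9 = t.reg 9 + G.weight S
  frame : ∀ r, r < 9 ∨ r = 10 ∨ r = 11 ∨ 22 < r → u.reg r = t.reg r
  clock : u.clock ≤ t.clock + 24 + 60 * G.weight S

variable {n : ℕ} {G : Multigraph n} {φ : ℝ} {M l B W lim : ℕ} {i : Fin n}

lemma Inv.congr {s t : State} (h : Inv G φ i l B W lim s) (h0 : t.mem = s.mem)
    (hr : ∀ r < 10, t.reg r = s.reg r) : Inv G φ i l B W lim t where
  reg1 := (hr 1 (by omega)).trans h.reg1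
  reg3 := (hr 3 (by omega)).trans h.reg3
  reg4 := (hr 4 (by omega)).trans h.reg4
  reg5 := (hr 5 (by omega)).trans h.reg5
  reg6 := (hr 6 (by omega)).trans h.reg6
  reg7 := (hr 7 (by omega)).trans h.reg7
  reg8 := (hr 8 (by omega)).trans h.reg8
  fresh := by rw [h0, hr 9 (by omega)]; exact h.fresh
  used := by rw [hr 9 (by omega)]; exact h.used
  out := by rw [h0, hr 0 (by omega)]; exact h.out

lemma wp_scored {S : Finset (Fin n)} {t : State} (hP : Setup G M B W lim)
    (h : Inv G φ i l B W lim t) (hS : Current G S t) (hu : t.reg 9 ≤ lim) (hw : G.weight S ≤ B) :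
    wp G φ M scorePhase (wp G φ M sumPhase (Scored G S t)) t := by
  have h1 : t.reg 9 * n + n < M :=
    lt_of_le_of_lt (Nat.add_le_add_right (Nat.mul_le_mul_right n hu) n) hP.index_lt
  have h2 := hP.lim_lt
  refine wp_mono (wp_scorePhase hP.deg_pos h.reg1 hS.1 hS.2 h.fresh h1 (by omega) hP.deg_lt
    hP.n_lt) ?_
  rintro u ⟨i1, i2, i3, i4, i5⟩
  refine wp_mono (wp_sumPhase i1 (hS.1.congr i2 (i4 10 (by omega))) h1.le (by omega)) ?_
  rintro v ⟨j1, j2, j3, j4, j5⟩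
  refine ⟨j1, j2.trans i2, j3, ?_, fun r hr => ?_, ?_⟩
  · rw [j4 9 (by omega), i3]
  · rw [j4 r (by omega), i4 r hr]
  · have := hS.1.card_eq
    have := G.card_le_weight hP.deg_pos S
    rw [i4 10 (by omega)] at j5
    omega

lemma Scored.holds_iff {S : Finset (Fin n)} {t u : State} (h : Scored G S t u)
    (hS : Current G S t) : Test.holds G φ M u (.ltPhi (.sub (.reg 11) (.reg 18)) (.reg 11)) ↔
      (G.cutSize S : ℝ) < φ * G.weight S := by
  have h11 : u.reg 11 = G.weight S := (h.frame 11 (by omega)).trans hS.2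
  have h1 : G.weight S - u.reg 18 = G.cutSize S := by have := h.cut; omega
  simp only [Test.holds, Expr.eval, h11, h1]

/-- A non-empty set has positive weight, so the next block starts beyond the one just used. -/
lemma Scored.fresh {S : Finset (Fin n)} {t u : State} (hP : Setup G M B W lim)
    (h : Scored G S t u) (hS : S.Nonempty) : ∀ x, u.reg 9 * n ≤ x → u.mem 1 x = 0 := by
  intro x hx
  refine h.scores.zero x (le_trans ?_ hx)
  have : 1 ≤ G.weight S := (Finset.card_pos.2 hS).trans_le (G.card_le_weight hP.deg_pos S)
  rw [h.used, add_mul]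
  nlinarith

lemma Scored.wp_found {S : Finset (Fin n)} {t u : State} (hP : Setup G M B W lim)
    (h : Scored G S t u) (hI : Inv G φ i l B W lim t) (hS : Current G S t) (hu : t.reg 9 ≤ lim)
    (hw : G.weight S ≤ B) (hne : S.Nonempty) (hc : (G.cutSize S : ℝ) < φ * G.weight S) (k : ℕ) :
    wp G φ M (.set 0 (.reg 10)) (fun v => Inv G φ i l B W lim v ∧ 0 < v.reg 0 ∧
      v.clock + 100 * t.reg 9 ≤ t.clock + k + 40 + 100 * v.reg 9) (u.tick k) := by
  have h10 : u.reg 10 = t.reg 10 := h.frame 10 (by omega)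
  have hl : Listed (u.mem 0) (u.reg 10) S := hS.1.congr h.mem0 h10
  rw [wp_set]
  refine ⟨⟨(h.frame 1 (by omega)).trans hI.reg1, (h.frame 3 (by omega)).trans hI.reg3,
    (h.frame 4 (by omega)).trans hI.reg4, (h.frame 5 (by omega)).trans hI.reg5,
    (h.frame 6 (by omega)).trans hI.reg6, (h.frame 7 (by omega)).trans hI.reg7,
    (h.frame 8 (by omega)).trans hI.reg8, by have hf := h.fresh hP hne; exact hf, ?_, fun _ => ⟨S, hl, hw, hc⟩⟩, ?_, ?_⟩
  · have : u.reg 9 ≤ lim + B := by have := h.used; omega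
    exact this
  · exact hl.pos_iff.2 hne
  · have h1 := h.clock
    have h2 := h.used
    simp only [State.setReg, State.tick, Expr.cost, Function.update_apply, Nat.reduceEqDiff,
      if_false]
    omega

lemma Scored.wp_select {S : Finset (Fin n)} {t u : State} (hP : Setup G M B W lim)
    (h : Scored G S t u) (hI : Inv G φ i l B W lim t) (h0 : t.reg 0 = 0) (hu : t.reg 9 ≤ lim)
    (hw : G.weight S ≤ B) (hne : S.Nonempty) {r : ℕ} (hr : r < W) (k : ℕ) :
    wp G φ M selectPhase (fun v => Inv G φ i l B W lim v ∧ v.reg 0 = 0 ∧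
      Current G (G.evolve W S r) v ∧ v.reg 9 = t.reg 9 + G.weight S ∧
      v.clock + 100 * t.reg 9 ≤ t.clock + k + 40 + 100 * v.reg 9) ((u.setReg 19 r).tick k) := by
  have h1 : t.reg 9 * n + n < M :=
    lt_of_le_of_lt (Nat.add_le_add_right (Nat.mul_le_mul_right n hu) n) hP.index_lt
  have e19 : ((u.setReg 19 r).tick k).reg 19 = r := by simp [State.setReg, State.tick]
  have efr : ∀ x, x ≠ 19 → ((u.setReg 19 r).tick k).reg x = u.reg x :=
    fun x hx => Function.update_of_ne hx _ _
  refine wp_mono (wp_selectPhase (W := W) hP.deg_pos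
    (h.scores.setReg r k (by decide) (by decide)) ?_ (e19.trans_lt hr) h1.le hP.n_lt hP.deg_lt
    hP.prod_lt) ?_
  · rw [efr 7 (by omega), h.frame 7 (by omega), hI.reg7]
  · rw [e19]
    rintro v ⟨j1, j2, j3, j4, j5⟩
    have fr : ∀ x < 9, v.reg x = t.reg x := fun x hx => by
      rw [j4 x (by omega), efr x (by omega), h.frame x (by omega)]
    have e9 : v.reg 9 = u.reg 9 := by rw [j4 9 (by omega), efr 9 (by omega)]
    have e0 : v.reg 0 = 0 := by rw [fr 0 (by omega), h0]
    refine ⟨⟨(fr 1 (by omega)).trans hI.reg1, (fr 3 (by omega)).trans hI.reg3,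
      (fr 4 (by omega)).trans hI.reg4, (fr 5 (by omega)).trans hI.reg5,
      (fr 6 (by omega)).trans hI.reg6, (fr 7 (by omega)).trans hI.reg7,
      (fr 8 (by omega)).trans hI.reg8, ?_, ?_, ?_⟩, e0, ⟨j1, j2⟩, e9.trans h.used, ?_⟩
    · rw [e9, j3]; exact h.fresh hP hne
    · have := h.used; omega
    · intro hp; omega
    · have k1 := h.clock
      have k2 := h.used
      have k3 := h.scores.cand.card_eq
      have k4 := G.card_score_pos_le S
      rw [efr 13 (by omega)] at j5
      have k5 : ((u.setReg 19 r).tick k).clock = u.clock + k := rfl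
      omega

/-- The cost is amortised: every unit of weight added to register `9` pays for `100` time units,
which leaves a constant per step. -/
lemma wp_evolveStep {S : Finset (Fin n)} {t : State} (hP : Setup G M B W lim)
    (hI : Inv G φ i l B W lim t) (h0 : t.reg 0 = 0) (hS : Current G S t) (hu : t.reg 9 ≤ lim)
    (hw : G.weight S ≤ B) (hne : S.Nonempty) :
    wp G φ M evolveStep (fun v => Inv G φ i l B W lim v ∧
      (v.reg 0 = 0 → ∃ T, Current G T v) ∧
      v.clock + 100 * t.reg 9 ≤ t.clock + 60 + 100 * v.reg 9) t := by
  rw [evolveStep, wp_seq]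
  refine wp_mono (wp_scored hP hI hS hu hw) fun s hs => ?_
  rw [wp_seq]
  refine wp_mono hs fun u h => ?_
  rw [wp_ite]
  constructor
  · intro hc
    refine wp_mono (h.wp_found hP hI hS hu hw hne ((h.holds_iff hS).1 hc) _) ?_
    rintro v ⟨i1, i2, i3⟩
    refine ⟨i1, fun h => by omega, ?_⟩
    simp only [Test.cost, Expr.cost] at i3
    omega
  · intro hc
    have h7 : u.reg 7 = W := by rw [h.frame 7 (by omega), hI.reg7]
    rw [wp_seq]
    refine wp_rand ?_ fun r hr => ?_
    · simp only [Expr.eval, State.tick, h7]; exact hP.W_pos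
    · simp only [Expr.eval, State.tick, h7] at hr
      refine wp_mono (h.wp_select hP hI h0 hu hw hne hr
        ((Test.ltPhi (.sub (.reg 11) (.reg 18)) (.reg 11)).cost + 1 + ((Expr.reg 7).cost + 1))) ?_
      rintro v ⟨i1, i2, i3, i4, i5⟩
      refine ⟨i1, fun _ => ⟨_, i3⟩, ?_⟩
      simp only [Test.cost, Expr.cost] at i5
      omega

lemma expect_evolveStep_le {S : Finset (Fin n)} {t : State} (hP : Setup G M B W lim)
    (hI : Inv G φ i l B W lim t) (h0 : t.reg 0 = 0) (hS : Current G S t) (hu : t.reg 9 ≤ lim)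
    (hw : G.weight S ≤ B) (hne : S.Nonempty) (f : State → ℝ≥0∞) (b : ℕ → ℝ≥0∞)
    (hfound : ∀ v, 0 < v.reg 0 → f v = 0)
    (hf : ∀ r < W, ∀ v, v.reg 0 = 0 → Current G (G.evolve W S r) v →
      v.reg 9 = t.reg 9 + G.weight S → f v ≤ b r) :
    expect (evolveStep.exec G φ M t) f ≤
      if (G.cutSize S : ℝ) < φ * G.weight S then 0 else (∑ r ∈ Finset.range W, b r) / W := by
  rw [evolveStep]
  refine expect_seq_le_of_wp (wp_scored hP hI hS hu hw) fun s hs => ?_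
  refine expect_seq_le_of_wp hs fun u h => ?_
  refine expect_ite_le (fun hc => ?_) fun hc => ?_
  · refine (expect_le_of_wp (h.wp_found hP hI hS hu hw hne ((h.holds_iff hS).1 hc) _)
      (b := 0) ?_).trans zero_le
    rintro v ⟨i1, i2, i3⟩
    exact (hfound v i2).le
  · rw [if_neg fun hc' => hc ((h.holds_iff hS).2 hc')]
    have h7 : u.reg 7 = W := by rw [h.frame 7 (by omega), hI.reg7]
    set k := (Test.ltPhi (.sub (.reg 11) (.reg 18)) (.reg 11)).cost + 1
    have e : Expr.eval G M (u.tick k) (.reg 7) = W := h7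
    have := expect_rand_seq_le (G := G) (φ := φ) (M := M) (r := 19) (e := .reg 7)
      (d := selectPhase) (f := f) (b := b) (s := u.tick k) (by rw [e]; exact hP.W_pos) ?_
    · rwa [e] at this
    · rw [e]
      intro r hr
      refine expect_le_of_wp (h.wp_select hP hI h0 hu hw hne hr
        (k + ((Expr.reg 7).cost + 1))) ?_
      rintro v ⟨i1, i2, i3, i4, i5⟩
      exact hf r hr v i2 i3 i4

end RAM

/-! ### The potential that bounds the failure probability -/

namespace RAM
variable {n : ℕ} {G : Multigraph n} {φ : ℝ} {M l B W lim : ℕ} {i : Fin n}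

/-- The set listed in array `0`. -/
def listedSet (n : ℕ) (t : State) : Finset (Fin n) :=
  Finset.univ.filter fun v => ∃ x < t.reg 10, t.mem 0 x = v

lemma Current.eq_listedSet {S : Finset (Fin n)} {t : State} (h : Current G S t) :
    listedSet n t = S := by
  ext v
  simp [listedSet, h.1.mem v]

/-- An upper bound for the probability that a computation does not find a set of small conductance
when `s` steps of the present run and `c` further runs are left. -/
noncomputable def potential (G : Multigraph n) (φ : ℝ) (i : Fin n) (l B W lim c s : ℕ)
    (t : State) : ℝ≥0∞ :=
  if 0 < t.reg 0 then 0 else if lim < t.reg 9 then 1 else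
    ENNReal.ofReal (t.reg 9 / lim +
      G.failProb W B φ s (listedSet n t) * G.failProb W B φ l {i} ^ c +
      (s * G.weight (listedSet n t) + c * l * G.weight {i}) / lim)

/-- The same bound between two runs. -/
noncomputable def runPotential (G : Multigraph n) (φ : ℝ) (i : Fin n) (l B W lim c : ℕ)
    (t : State) : ℝ≥0∞ :=
  if 0 < t.reg 0 then 0 else if lim < t.reg 9 then 1 else
    ENNReal.ofReal (t.reg 9 / lim + G.failProb W B φ l {i} ^ c + c * l * G.weight {i} / lim)

lemma potential_congr {c s : ℕ} {t u : State} (h0 : t.mem 0 = u.mem 0)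
    (h1 : ∀ r < 11, t.reg r = u.reg r) :
    potential G φ i l B W lim c s t = potential G φ i l B W lim c s u := by
  unfold potential listedSet
  rw [h0, h1 0 (by omega), h1 9 (by omega), h1 10 (by omega)]

lemma expect_skip_le (t : State) (f : State → ℝ≥0∞) :
    expect (Cmd.skip.exec G φ M t) f = f (t.tick 1) := by
  rw [Cmd.exec, expect_pure]

/-- On a stopped set `failProb` is `1` for any number of steps; only the reserve for future weight
depends on `s`. -/
lemma potential_step_mono (c s : ℕ) {S : Finset (Fin n)} {t : State}
    (hS : t.reg 0 = 0 → listedSet n t = S) (hdead : S = ∅ ∨ B < G.weight S) :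
    potential G φ i l B W lim c s t ≤ potential G φ i l B W lim c (s + 1) t := by
  unfold potential
  split_ifs with h0
  · exact le_rfl
  · exact le_rfl
  · rw [hS (by omega), G.failProb_stopped hdead, G.failProb_stopped hdead]
    gcongr
    linarith

lemma ofReal_avg {W : ℕ} (hW : 0 < W) {b : ℕ → ℝ} (hb : ∀ r, 0 ≤ b r) :
    (∑ r ∈ Finset.range W, ENNReal.ofReal (b r)) / W =
      ENNReal.ofReal ((∑ r ∈ Finset.range W, b r) / W) := by
  rw [← ENNReal.ofReal_sum_of_nonneg fun r _ => hb r,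
    ENNReal.ofReal_div_of_pos (by exact_mod_cast hW), ENNReal.ofReal_natCast]

/-- The potential adds the failure probability with unlimited budget to a Markov bound for exceeding
the budget: weight used plus a bound for the expected weight still to come, over `lim`. The first
part averages by the recursion for `failProb`, the second because the mean weight does not grow. -/
lemma expect_evolveStep_potential_le {S : Finset (Fin n)} {t : State} {H : ℕ}
    (hP : Setup G M B W lim) (hH : W = 2 * H)
    (hI : Inv G φ i l B W lim t) (h0 : t.reg 0 = 0) (hS : Current G S t) (hu : t.reg 9 ≤ lim)
    (hw : G.weight S ≤ B) (hne : S.Nonempty) (c s : ℕ) :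
    expect (evolveStep.exec G φ M t) (potential G φ i l B W lim c s) ≤
      potential G φ i l B W lim c (s + 1) t := by
  have hlim : (0 : ℝ) < lim := by exact_mod_cast hP.lim_pos
  have hW : (0 : ℝ) < W := by exact_mod_cast hP.W_pos
  set q := G.failProb W B φ l {i} with hq
  have hq0 : 0 ≤ q := G.failProb_nonneg _ _ _ _ _
  set b : ℕ → ℝ := fun r => ((t.reg 9 + G.weight S : ℕ) : ℝ) / lim +
      G.failProb W B φ s (G.evolve W S r) * q ^ c +
      (s * G.weight (G.evolve W S r) + c * l * G.weight {i}) / lim with hb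
  have hb0 : ∀ r, 0 ≤ b r := fun r => by
    have := G.failProb_nonneg W B φ s (G.evolve W S r)
    positivity
  refine (expect_evolveStep_le hP hI h0 hS hu hw hne _ (fun r => ENNReal.ofReal (b r)) ?_ ?_).trans
    ?_
  · intro v hv
    rw [potential, if_pos hv]
  · intro r hr v hv0 hv hv9
    rw [potential, if_neg (by omega)]
    split_ifs with hex
    · rw [ENNReal.one_le_ofReal, hb]
      -- If the budget is now exceeded, the weight used alone accounts for the value `1`.
      have h1 : 1 ≤ ((t.reg 9 + G.weight S : ℕ) : ℝ) / lim := by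
        rw [one_le_div hlim, ← hv9]; exact_mod_cast hex.le
      have := G.failProb_nonneg W B φ s (G.evolve W S r)
      have h2 : 0 ≤ G.failProb W B φ s (G.evolve W S r) * q ^ c := by positivity
      have h3 : 0 ≤ ((s : ℝ) * G.weight (G.evolve W S r) + c * l * G.weight {i}) / lim := by
        positivity
      simp only
      linarith
    · rw [hv9, hv.eq_listedSet]
  · have hdead : ¬(S = ∅ ∨ B < G.weight S) := by
      rintro (h | h)
      · exact hne.ne_empty h
      · omega
    by_cases hc : (G.cutSize S : ℝ) < φ * G.weight S
    · rw [if_pos hc]; exact zero_le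
    · rw [if_neg hc]
      have hpot : potential G φ i l B W lim c (s + 1) t = ENNReal.ofReal (t.reg 9 / lim +
          (∑ r ∈ Finset.range W, G.failProb W B φ s (G.evolve W S r)) / W * q ^ c +
          (((s + 1 : ℕ) : ℝ) * G.weight S + c * l * G.weight {i}) / lim) := by
        rw [potential, if_neg (by omega), if_neg (by omega), hS.eq_listedSet,
          Multigraph.failProb, if_neg hdead, if_neg hc]
      rw [hpot, ofReal_avg hP.W_pos hb0]
      refine ENNReal.ofReal_le_ofReal ?_
      have hsum : ((∑ r ∈ Finset.range W, G.weight (G.evolve W S r) : ℕ) : ℝ) ≤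
          ((W * G.weight S : ℕ) : ℝ) := by
        subst hH; exact_mod_cast G.sum_weight_evolve_le H hP.deg_pos S
      push_cast at hsum
      have e : (∑ r ∈ Finset.range W, b r) / W = ((t.reg 9 : ℝ) + G.weight S) / lim +
          (∑ r ∈ Finset.range W, G.failProb W B φ s (G.evolve W S r)) / W * q ^ c +
          (s * ((∑ r ∈ Finset.range W, (G.weight (G.evolve W S r) : ℝ)) / W) +
            c * l * G.weight {i}) / lim := by
        simp only [hb, Finset.sum_add_distrib, ← Finset.sum_div, ← Finset.sum_mul,
          ← Finset.mul_sum, Finset.sum_const, Finset.card_range, nsmul_eq_mul]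
        push_cast
        field_simp
      rw [e]
      have h1 : (∑ r ∈ Finset.range W, (G.weight (G.evolve W S r) : ℝ)) / W ≤ G.weight S := by
        rw [div_le_iff₀ hW]; linarith
      have h2 : ((s : ℝ) * ((∑ r ∈ Finset.range W, (G.weight (G.evolve W S r) : ℝ)) / W) +
            c * l * G.weight {i}) / lim ≤ (s * G.weight S + c * l * G.weight {i}) / lim := by
        gcongr
      -- The weight of `S` passes from the reserve to the weight used.
      have h3 : ((t.reg 9 : ℝ) + G.weight S) / lim + (s * G.weight S + c * l * G.weight {i}) / lim =
          t.reg 9 / lim + (((s + 1 : ℕ) : ℝ) * G.weight S + c * l * G.weight {i}) / lim := by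
        push_cast
        ring
      linarith

/-- The invariant between two steps of a run. -/
def StepInv (G : Multigraph n) (φ : ℝ) (i : Fin n) (l B W lim : ℕ) (t : State) : Prop :=
  Inv G φ i l B W lim t ∧ (t.reg 0 = 0 → ∃ S, Current G S t)

lemma StepInv.setReg {t : State} (h : StepInv G φ i l B W lim t) {r : ℕ} (hr : 11 < r)
    (x k : ℕ) : StepInv G φ i l B W lim ((t.setReg r x).tick k) := by
  have e : ∀ y < 12, ((t.setReg r x).tick k).reg y = t.reg y := fun y hy =>
    Function.update_of_ne (by omega) _ _
  refine ⟨h.1.congr rfl fun y hy => e y (by omega), fun h0 => ?_⟩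
  rw [e 0 (by omega)] at h0
  obtain ⟨S, h1, h2⟩ := h.2 h0
  exact ⟨S, h1.congr rfl (e 10 (by omega)), (e 11 (by omega)).trans h2⟩

lemma StepInv.tick {t : State} (h : StepInv G φ i l B W lim t) (k : ℕ) :
    StepInv G φ i l B W lim (t.tick k) := ⟨h.1.congr rfl fun _ _ => rfl, h.2⟩

lemma Current.tick {S : Finset (Fin n)} {t : State} (h : Current G S t) (k : ℕ) :
    Current G S (t.tick k) := h

lemma guard_zero {t : State} (r : ℕ) :
    Test.holds G φ M t (.lt (.lit 0) (.reg r)) ↔ 0 < t.reg r := by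
  simp [Test.holds, Expr.eval]

lemma guard_lt {t : State} (r r' : ℕ) :
    Test.holds G φ M t (.lt (.reg r) (.reg r')) ↔ t.reg r < t.reg r' := by
  simp [Test.holds, Expr.eval]

lemma wp_guardedStep {t : State} (hP : Setup G M B W lim)
    (h : StepInv G φ i l B W lim t) :
    wp G φ M guardedStep (fun v => StepInv G φ i l B W lim v ∧
      v.clock + 100 * t.reg 9 ≤ t.clock + 100 + 100 * v.reg 9) t := by
  have hskip : ∀ k ≤ 40, wp G φ M .skip (fun v => StepInv G φ i l B W lim v ∧
      v.clock + 100 * t.reg 9 ≤ t.clock + 100 + 100 * v.reg 9) (t.tick k) := by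
    intro k hk
    rw [wp_skip]
    refine ⟨(h.tick k).tick 1, ?_⟩
    simp only [State.tick]
    omega
  have htick : ∀ a b, (t.tick a).tick b = t.tick (a + b) := fun a b => by
    simp [State.tick, add_assoc]
  rw [guardedStep, wp_ite]
  simp only [wp_ite, guard_zero, guard_lt, htick]
  refine ⟨fun _ => hskip _ (by decide), fun h0 => ⟨fun _ => hskip _ (by decide), fun h1 =>
    ⟨fun _ => hskip _ (by decide), fun h2 => ⟨fun h3 => ?_, fun _ => hskip _ (by decide)⟩⟩⟩⟩
  simp only [State.tick] at h0 h1 h2 h3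
  obtain ⟨S, hS⟩ := h.2 (by omega)
  have hw : G.weight S ≤ B := by rw [← hS.2, ← h.1.reg5]; omega
  have hu : t.reg 9 ≤ lim := by rw [← h.1.reg8]; omega
  refine wp_mono (wp_evolveStep hP (h.tick _).1 (by simp only [State.tick]; omega)
    (hS.tick _) hu hw (hS.1.pos_iff.1 h3)) ?_
  rintro v ⟨i1, i2, i3⟩
  refine ⟨⟨i1, i2⟩, ?_⟩
  simp only [State.tick, Test.cost, Expr.cost] at i3
  omega

lemma expect_guardedStep_le {t : State} {H : ℕ} (hP : Setup G M B W lim) (hH : W = 2 * H)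
    (h : StepInv G φ i l B W lim t) (c s : ℕ) :
    expect (guardedStep.exec G φ M t) (potential G φ i l B W lim c s) ≤
      potential G φ i l B W lim c (s + 1) t := by
  have ht : ∀ s k, potential G φ i l B W lim c s (t.tick k) = potential G φ i l B W lim c s t :=
    fun s k => potential_congr rfl fun _ _ => rfl
  refine expect_ite_le (fun h0 => ?_) fun h0 => expect_ite_le (fun h1 => ?_) fun h1 =>
    expect_ite_le (fun h2 => ?_) fun h2 => expect_ite_le (fun h3 => ?_) fun h3 => ?_
  all_goals simp only [guard_zero, guard_lt, State.tick] at *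
  · rw [expect_skip_le, potential, if_pos (by exact h0)]; exact zero_le
  · rw [h.1.reg8] at h1
    rw [expect_skip_le, potential, potential, if_neg (by exact h0), if_pos (by exact h1),
      if_neg h0, if_pos h1]
  · obtain ⟨S, hS⟩ := h.2 (by omega)
    rw [hS.2, h.1.reg5] at h2
    rw [expect_skip_le]
    refine le_trans (le_of_eq ?_) (potential_step_mono (S := S) c s (fun _ => hS.eq_listedSet)
      (Or.inr h2))
    exact potential_congr rfl fun _ _ => rfl
  · obtain ⟨S, hS⟩ := h.2 (by omega)
    rw [hS.2, h.1.reg5] at h2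
    rw [h.1.reg8] at h1
    have key : ∀ k, expect (evolveStep.exec G φ M ⟨t.reg, t.mem, k⟩)
        (potential G φ i l B W lim c s) ≤ potential G φ i l B W lim c (s + 1) t := fun k => by
      refine (expect_evolveStep_potential_le (S := S) (t := ⟨t.reg, t.mem, k⟩) hP hH
        (h.1.congr rfl fun _ _ => rfl) (by simp only; omega) hS (not_lt.1 h1) (not_lt.1 h2)
        (hS.1.pos_iff.1 h3) c s).trans_eq ?_
      exact potential_congr rfl fun _ _ => rfl
    exact key _
  · obtain ⟨S, hS⟩ := h.2 (by omega)
    rw [hS.1.pos_iff, Finset.not_nonempty_iff_eq_empty] at h3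
    rw [expect_skip_le]
    refine le_trans (le_of_eq ?_) (potential_step_mono (S := S) c s (fun _ => hS.eq_listedSet)
      (Or.inl h3))
    exact potential_congr rfl fun _ _ => rfl

/-- Stated for an arbitrary `P`, so that the sure analysis and the analysis in expectation share
this start of a run. -/
lemma StepInv.init {t : State} (hP : Setup G M B W lim)
    (hI : Inv G φ i l B W lim t) (h0 : t.reg 0 = 0) {P : State → Prop}
    (h : ∀ u, Inv G φ i l B W lim u → Current G {i} u → u.reg 0 = 0 → u.reg 9 = t.reg 9 →
      u.clock = t.clock + 7 → P u) :
    P (((((t.setMem 0 ((Expr.lit 0).eval G M t) ((Expr.reg 3).eval G M t)).tick 3).setReg 10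
      (1 % M)).tick 2 |>.setReg 11 (t.reg 6)).tick 2) := by
  have h1 : 1 % M = 1 := Nat.mod_eq_of_lt (by have := hP.n_lt; have := i.2; omega)
  have hl : Listed (Function.update (t.mem 0) 0 (i : ℕ)) 1 ({i} : Finset (Fin n)) := by
    have := (Listed.empty (f := t.mem 0)).snoc (Finset.notMem_empty i)
    simpa using this
  have fr : ∀ r < 10, (((((t.setMem 0 ((Expr.lit 0).eval G M t) ((Expr.reg 3).eval G M t)).tick
      3).setReg 10 (1 % M)).tick 2 |>.setReg 11 (t.reg 6)).tick 2).reg r = t.reg r := by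
    intro r hr
    simp only [State.tick, State.setReg, State.setMem]
    rw [Function.update_of_ne (by omega), Function.update_of_ne (by omega)]
  have hm : ∀ a, a ≠ 0 → (((((t.setMem 0 ((Expr.lit 0).eval G M t) ((Expr.reg 3).eval G M t)).tick
      3).setReg 10 (1 % M)).tick 2 |>.setReg 11 (t.reg 6)).tick 2).mem a = t.mem a := by
    intro a ha
    simp only [State.tick, State.setReg, State.setMem]
    rw [Function.update_of_ne ha]
  refine h _ ⟨?_, ?_, ?_, ?_, ?_, ?_, ?_, ?_, ?_, ?_⟩ ⟨?_, ?_⟩ ?_ ?_ ?_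
  · rw [fr 1 (by omega), hI.reg1]
  · rw [fr 3 (by omega), hI.reg3]
  · rw [fr 4 (by omega), hI.reg4]
  · rw [fr 5 (by omega), hI.reg5]
  · rw [fr 6 (by omega), hI.reg6]
  · rw [fr 7 (by omega), hI.reg7]
  · rw [fr 8 (by omega), hI.reg8]
  · rw [fr 9 (by omega), hm 1 (by omega)]; exact hI.fresh
  · rw [fr 9 (by omega)]; exact hI.used
  · rw [fr 0 (by omega)]; intro hp; omega
  · simpa [State.tick, State.setReg, State.setMem, Expr.eval, hI.reg3, h1] using hl
  · simp [State.tick, State.setReg, State.setMem, hI.reg6]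
  · rw [fr 0 (by omega), h0]
  · rw [fr 9 (by omega)]
  · simp [State.tick, State.setReg, State.setMem]

end RAM

/-! ### Runs and the main loop -/

namespace RAM
variable {n : ℕ} {G : Multigraph n} {φ : ℝ} {M l B W lim : ℕ} {i : Fin n}

/-- The invariant in a run that was started in the state `t`. -/
def RunInv (G : Multigraph n) (φ : ℝ) (i : Fin n) (l B W lim : ℕ) (t : State) (k : ℕ)
    (v : State) : Prop :=
  StepInv G φ i l B W lim v ∧ v.clock + 100 * t.reg 9 ≤ t.clock + 20 + 101 * k + 100 * v.reg 9

lemma RunInv.step {t v : State} (hP : Setup G M B W lim) {k : ℕ}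
    (h : RunInv G φ i l B W lim t k v) :
    wp G φ M guardedStep (RunInv G φ i l B W lim t (k + 1)) ((v.setReg 24 k).tick 1) := by
  refine wp_mono (wp_guardedStep hP (h.1.setReg (r := 24) (by omega) k 1)) ?_
  rintro w ⟨i1, i2⟩
  refine ⟨i1, ?_⟩
  have h2 := h.2
  simp only [State.tick, State.setReg, Function.update_apply, Nat.reduceEqDiff, if_false] at i2
  omega

lemma wp_evolveRun {t : State} (hP : Setup G M B W lim) (hI : Inv G φ i l B W lim t) :
    wp G φ M evolveRun (fun v => Inv G φ i l B W lim v ∧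
      v.clock + 100 * t.reg 9 ≤ t.clock + 20 + 101 * l + 100 * v.reg 9) t := by
  rw [evolveRun, wp_ite]
  refine ⟨fun _ => ?_, fun h0 => ?_⟩
  · rw [wp_skip]
    refine ⟨hI.congr rfl fun _ _ => rfl, ?_⟩
    simp only [State.tick, Test.cost, Expr.cost]
    omega
  · rw [guard_zero, not_lt, Nat.le_zero] at h0
    rw [wp_seq, wp_write, wp_seq, wp_set, wp_seq, wp_set]
    refine StepInv.init (t := t.tick 4) (i := i) hP (hI.congr rfl fun _ _ => rfl) h0 ?_
    intro u hu1 hu2 hu3 hu4 hu5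
    have e4 : Expr.eval G M u (.reg 4) = l := hu1.reg4
    refine wp_loop (RunInv G φ i l B W lim t) ⟨⟨hu1.congr rfl fun _ _ => rfl, fun _ => ⟨_, hu2⟩⟩, ?_⟩
      (fun k _ v hv => hv.step hP) ?_
    · simp only [State.tick] at hu4 hu5
      simp only [State.tick, Expr.cost]
      omega
    · rw [e4]
      rintro v ⟨h1, h2⟩
      exact ⟨h1.1, h2⟩

/-- A run starts at `{i}` with `l` steps left, where the potential contains `q * q ^ c = q ^ (c +
1)`; with no steps left it equals the potential between runs. -/
lemma expect_evolveRun_le {t : State} {H : ℕ} (hP : Setup G M B W lim) (hH : W = 2 * H)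
    (hI : Inv G φ i l B W lim t) (c : ℕ) :
    expect (evolveRun.exec G φ M t) (runPotential G φ i l B W lim c) ≤
      runPotential G φ i l B W lim (c + 1) t := by
  rw [evolveRun]
  refine expect_ite_le (fun h0 => ?_) fun h0 => ?_
  · rw [guard_zero] at h0
    rw [expect_skip_le, runPotential, if_pos (by exact h0)]
    exact zero_le
  · rw [guard_zero, not_lt, Nat.le_zero] at h0
    have hset : ∀ (s : State) r e, Cmd.exec G φ M (.set r e) s =
      PMF.pure ((s.setReg r (e.eval G M s)).tick (e.cost + 1)) := fun _ _ _ => by rw [Cmd.exec]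
    rw [Cmd.exec, Cmd.exec, PMF.pure_bind, Cmd.exec, hset, PMF.pure_bind, Cmd.exec, hset,
      PMF.pure_bind]
    refine StepInv.init (P := fun u => expect (Cmd.exec G φ M (.loop 24 (.reg 4) guardedStep) u)
      (runPotential G φ i l B W lim c) ≤ _) (t := t.tick 4) (i := i) hP
      (hI.congr rfl fun _ _ => rfl) h0 ?_
    intro u hu1 hu2 hu3 hu4 hu5
    have e4 : Expr.eval G M u (.reg 4) = l := hu1.reg4
    refine le_trans (b := expect (Cmd.exec G φ M (.loop 24 (.reg 4) guardedStep) u)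
      (potential G φ i l B W lim c (l - l))) ?_ ?_
    · refine expect_mono_support _ fun v _ => ?_
      rw [Nat.sub_self, runPotential, potential]
      split_ifs
      · exact le_rfl
      · exact le_rfl
      · refine ENNReal.ofReal_le_ofReal (le_of_eq ?_)
        rw [Multigraph.failProb]
        simp
    · have key := expect_loop_le (G := G) (φ := φ) (M := M) (s := u) (r := 24) (e := .reg 4)
        (c := guardedStep)
        (fun _ v => StepInv G φ i l B W lim v)
        (fun k => potential G φ i l B W lim c (l - k)) ?_ ?_ ?_
      · rw [e4] at key
        refine key.trans (le_of_eq ?_)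
        have hc : Current G {i} (u.tick ((Expr.reg 4).cost + 1)) := hu2
        rw [Nat.sub_zero, potential, runPotential, hc.eq_listedSet]
        have e0 : (u.tick ((Expr.reg 4).cost + 1)).reg 0 = 0 := hu3
        have e9 : (u.tick ((Expr.reg 4).cost + 1)).reg 9 = t.reg 9 := hu4
        rw [e0, e9, h0]
        congr 3
        rw [pow_succ']
        push_cast
        ring
      · exact ⟨hu1.congr rfl fun _ _ => rfl, fun _ => ⟨_, hu2⟩⟩
      · intro k _ v hv
        exact wp_mono (wp_guardedStep hP (hv.setReg (r := 24) (by omega) k 1)) fun w hw => hw.1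
      · intro k hk v hv
        rw [e4] at hk
        have := expect_guardedStep_le (s := l - (k + 1)) (c := c) hP hH
          (hv.setReg (r := 24) (by omega) k 1)
        rw [show l - (k + 1) + 1 = l - k by omega] at this
        refine this.trans (le_of_eq (potential_congr rfl fun r hr => ?_))
        exact Function.update_of_ne (by omega) _ _

lemma Inv.setReg {t : State} (h : Inv G φ i l B W lim t) {r : ℕ} (hr : 9 < r)
    (x k : ℕ) : Inv G φ i l B W lim ((t.setReg r x).tick k) :=
  h.congr rfl fun _ _ => Function.update_of_ne (by omega) _ _

lemma eval_runs {t : State} (hI : Inv G φ i l B W lim t) (hlB : l * B + 1 < M) :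
    Expr.eval G M t (.add (.div (.mul (.reg 4) (.reg 5)) (.reg 6)) (.lit 1)) =
      l * B / G.weight {i} + 1 := by
  have h1 : l * B / G.weight {i} ≤ l * B := Nat.div_le_self _ _
  simp only [Expr.eval, hI.reg4, hI.reg5, hI.reg6]
  rw [Nat.mod_eq_of_lt (a := l * B) (by omega), Nat.mod_eq_of_lt (a := 1) (by omega),
    Nat.mod_eq_of_lt (by omega)]

lemma wp_mainLoop {t : State} (hP : Setup G M B W lim) (hI : Inv G φ i l B W lim t)
    (hlB : l * B + 1 < M) :
    wp G φ M mainLoop (fun v => Inv G φ i l B W lim v ∧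
      v.clock ≤ t.clock + 10 + (l * B / G.weight {i} + 1) * (21 + 101 * l) +
        100 * (lim + B)) t := by
  have e := eval_runs hI hlB
  refine wp_loop (fun k v => Inv G φ i l B W lim v ∧
    v.clock + 100 * t.reg 9 ≤ t.clock + 10 + k * (21 + 101 * l) + 100 * v.reg 9) ?_ ?_ ?_
  · refine ⟨hI.congr rfl fun _ _ => rfl, ?_⟩
    simp only [State.tick, Expr.cost]
    omega
  · rintro k _ v ⟨h1, h2⟩
    refine wp_mono (wp_evolveRun hP (h1.setReg (r := 23) (by omega) k 1)) ?_
    rintro w ⟨i1, i2⟩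
    refine ⟨i1, ?_⟩
    simp only [State.tick, State.setReg, Function.update_apply, Nat.reduceEqDiff, if_false] at i2
    rw [add_mul, one_mul]
    omega
  · rw [e]
    rintro v ⟨h1, h2⟩
    refine ⟨h1, ?_⟩
    have := h1.used
    omega

/-- With no runs left the potential is at least `1` unless a set was found, so its initial value
bounds the failure probability. -/
lemma expect_mainLoop_le {t : State} {H : ℕ} (hP : Setup G M B W lim) (hH : W = 2 * H)
    (hI : Inv G φ i l B W lim t) (hlB : l * B + 1 < M) (h9 : t.reg 9 = 0) :
    expect (mainLoop.exec G φ M t) (fun v => if v.reg 0 = 0 then 1 else 0) ≤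
      ENNReal.ofReal (G.failProb W B φ l {i} ^ (l * B / G.weight {i} + 1) +
        (l * B / G.weight {i} + 1 : ℕ) * l * G.weight {i} / lim) := by
  have e := eval_runs hI hlB
  set N := l * B / G.weight {i} + 1
  refine le_trans (b := expect (mainLoop.exec G φ M t) (runPotential G φ i l B W lim (N - N)))
    (expect_mono_support _ fun v _ => ?_) ?_
  · rw [Nat.sub_self]
    unfold runPotential
    split_ifs
    · omega
    · exact le_rfl
    · rw [ENNReal.one_le_ofReal]
      have : (0 : ℝ) ≤ v.reg 9 / lim := by positivity
      simpa using this
    · exact zero_le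
    · exact zero_le
    · exact zero_le
  · have key := expect_loop_le (G := G) (φ := φ) (M := M) (s := t) (r := 23)
      (e := .add (.div (.mul (.reg 4) (.reg 5)) (.reg 6)) (.lit 1)) (c := evolveRun)
      (fun _ v => Inv G φ i l B W lim v) (fun k => runPotential G φ i l B W lim (N - k)) ?_ ?_ ?_
    · rw [e] at key
      refine key.trans ?_
      unfold runPotential
      split_ifs with q1 q2
      · exact zero_le
      · simp only [State.tick, h9] at q2
        omega
      · simp [State.tick, h9]
    · exact hI.congr rfl fun _ _ => rfl
    · intro k _ v hv
      exact wp_mono (wp_evolveRun hP (hv.setReg (r := 23) (by omega) k 1)) fun w hw => hw.1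
    · intro k hk v hv
      rw [e] at hk
      have := expect_evolveRun_le (c := N - (k + 1)) hP hH (hv.setReg (r := 23) (by omega) k 1)
      rw [show N - (k + 1) + 1 = N - k by omega] at this
      refine this.trans (le_of_eq ?_)
      simp [runPotential, State.tick, State.setReg]

end RAM

/-! ### Initialisation and choice of parameters -/

namespace RAM
variable {n : ℕ} {G : Multigraph n} {φ : ℝ} {M l B : ℕ} {i : Fin n}

/-- As `B ≤ m` and `n ≤ m`, all relevant numbers are small multiples of `l³m³` at most. -/
lemma Setup.of_lt (hd : ∀ v, 0 < G.deg v) (hn : n ≤ G.totalDeg) (hl : 0 < l) (hB : 0 < B)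
    (hBm : B ≤ G.totalDeg) (hM : 16 * l ^ 3 * G.totalDeg ^ 3 < M) :
    Setup G M B (2 * (2 * G.totalDeg * l)) (l ^ 3 * B) := by
  set m := G.totalDeg
  have hm : 0 < m := hB.trans_le hBm
  have hl3 : l ≤ l ^ 3 := Nat.le_self_pow (by norm_num) l
  have hm3 : m ≤ m ^ 3 := Nat.le_self_pow (by norm_num) m
  have hm2 : m ^ 2 ≤ m ^ 3 := Nat.pow_le_pow_right hm (by norm_num)
  have h1 : m ^ 3 ≤ l ^ 3 * m ^ 3 := Nat.le_mul_of_pos_left _ (by positivity)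
  have h2 : l * m ^ 2 ≤ l ^ 3 * m ^ 3 := Nat.mul_le_mul hl3 hm2
  have h3 : l ^ 3 * m ≤ l ^ 3 * m ^ 3 := Nat.mul_le_mul_left _ hm3
  have h4 : l ^ 3 * B ≤ l ^ 3 * m := Nat.mul_le_mul_left _ hBm
  have h5 : l ^ 3 * B * n ≤ l ^ 3 * m ^ 3 := by
    calc l ^ 3 * B * n ≤ l ^ 3 * m * m := by gcongr
      _ = l ^ 3 * m ^ 2 := by ring
      _ ≤ _ := by gcongr
  have hM' : 16 * (l ^ 3 * m ^ 3) < M := by rwa [← mul_assoc]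
  refine ⟨hd, by omega, by omega, ?_, by omega, by omega, by positivity, by positivity⟩
  have : 2 * (2 * m * l) * (2 * m) = 8 * (l * m ^ 2) := by ring
  rw [this]
  omega

lemma exec_cutOrBound (hd : ∀ v, 0 < G.deg v) (hn : n ≤ G.totalDeg) (hl : 0 < l)
    (hB : 0 < B) (hBm : B ≤ G.totalDeg) (hM : 16 * l ^ 3 * G.totalDeg ^ 3 < M) :
    (B < G.weight {i} ∧ ∃ t : State, t.reg 0 = 0 ∧ t.clock ≤ 20 ∧
      cutOrBound.exec G φ M (initState M n G.totalDeg i l B) = PMF.pure t) ∨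
    (G.weight {i} ≤ B ∧ ∃ t : State,
      Inv G φ i l B (2 * (2 * G.totalDeg * l)) (l ^ 3 * B) t ∧ t.reg 9 = 0 ∧ t.clock ≤ 60 ∧
      cutOrBound.exec G φ M (initState M n G.totalDeg i l B) = mainLoop.exec G φ M t) := by
  have hP := Setup.of_lt hd hn hl hB hBm hM
  set m := G.totalDeg with hm
  have hm0 : 0 < m := hB.trans_le hBm
  have hi := i.2
  have hdi : G.deg i ≤ m := G.deg_le_totalDeg i
  have a1 := hP.n_lt
  have a2 := hP.deg_lt
  have a3 := hP.prod_lt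
  have a4 := hP.lim_lt
  have a5 : l ≤ l ^ 3 := Nat.le_self_pow (by norm_num) l
  have a6 : l ^ 3 ≤ l ^ 3 * B := Nat.le_mul_of_pos_right _ hB
  have a7 : l * B ≤ l ^ 3 * B := Nat.mul_le_mul_right _ a5
  have a8 : l * (l * B) ≤ l ^ 3 * B := by
    calc l * (l * B) = l ^ 2 * B := by ring
      _ ≤ l ^ 3 * B := Nat.mul_le_mul_right _ (Nat.pow_le_pow_right hl (by norm_num))
  have a9 : l * (l * (l * B)) = l ^ 3 * B := by ring
  have a10 : 2 * (2 * m * l) ≤ 2 * (2 * m * l) * (2 * m) := Nat.le_mul_of_pos_right _ (by omega)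
  rw [← hm] at a2 a3
  have a12 := lt_of_le_of_lt a10 a3
  have a11 : 4 * (m * l) = 2 * (2 * m * l) := by ring
  have e1 : n % M = n := Nat.mod_eq_of_lt a1
  have e2 : m % M = m := Nat.mod_eq_of_lt (by omega)
  have e3 : (i : ℕ) % M = i := Nat.mod_eq_of_lt (by omega)
  have e4 : l % M = l := Nat.mod_eq_of_lt (by omega)
  have e5 : B % M = B := Nat.mod_eq_of_lt (by omega)
  have e6 : G.deg i % M = G.deg i := Nat.mod_eq_of_lt (by omega)
  have e7 : 2 % M = 2 := Nat.mod_eq_of_lt (by omega)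
  have e8 : 2 * G.deg i % M = 2 * G.deg i := Nat.mod_eq_of_lt (by omega)
  have e9 : m * l % M = m * l := Nat.mod_eq_of_lt (by omega)
  have hml : 0 < m * l := by positivity
  have e10 : 4 % M = 4 := Nat.mod_eq_of_lt (by omega)
  have e11 : 4 * (m * l) % M = 4 * (m * l) := Nat.mod_eq_of_lt (by omega)
  have e12 : l * B % M = l * B := Nat.mod_eq_of_lt (by omega)
  have e13 : l * (l * B) % M = l * (l * B) := Nat.mod_eq_of_lt (by omega)
  have e14 : l * (l * (l * B)) % M = l * (l * (l * B)) := Nat.mod_eq_of_lt (by omega)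
  set s0 := initState M n m i l B with hs0
  have r1 : s0.reg 1 = n := e1
  have r2 : s0.reg 2 = m := e2
  have r3 : s0.reg 3 = i := e3
  have r4 : s0.reg 4 = l := e4
  have r5 : s0.reg 5 = B := e5
  have r0 : s0.reg 0 = 0 := rfl
  have r9 : s0.reg 9 = 0 := rfl
  have hmem : ∀ a x, s0.mem a x = 0 := fun _ _ => rfl
  have hclock : s0.clock = 0 := rfl
  clear_value s0
  have hset : ∀ (s : State) r e, Cmd.exec G φ M (.set r e) s =
    PMF.pure ((s.setReg r (e.eval G M s)).tick (e.cost + 1)) := fun _ _ _ => by rw [Cmd.exec]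
  rw [cutOrBound, Cmd.exec, hset, PMF.pure_bind, Cmd.exec, Multigraph.weight_singleton]
  have hev : (Expr.mul (.lit 2) (.deg (.reg 3))).eval G M s0 = 2 * G.deg i := by
    simp only [Expr.eval, r3, e7, degQuery_val, e6, e8]
  rw [hev]
  have hguard : Test.holds G φ M ((s0.setReg 6 (2 * G.deg i)).tick
      ((Expr.mul (.lit 2) (.deg (.reg 3))).cost + 1)) (.lt (.reg 5) (.reg 6)) ↔
      B < 2 * G.deg i := by
    simp [guard_lt, State.setReg, State.tick, r5]
  by_cases hlt : B < 2 * G.deg i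
  · left
    rw [if_pos (hguard.2 hlt), Cmd.exec]
    refine ⟨hlt, _, ?_, ?_, rfl⟩
    · simp [State.setReg, State.tick, r0]
    · simp [State.setReg, State.tick, hclock, Expr.cost, Test.cost]
  · right
    rw [if_neg (fun h => hlt (hguard.1 h)), Cmd.exec, hset, PMF.pure_bind, Cmd.exec, hset,
      PMF.pure_bind]
    refine ⟨not_lt.1 hlt, _, ⟨?_, ?_, ?_, ?_, ?_, ?_, ?_, ?_, ?_, ?_⟩, ?_, ?_, rfl⟩
    · simp [State.setReg, State.tick, r1]
    · simp [State.setReg, State.tick, r3]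
    · simp [State.setReg, State.tick, r4]
    · simp [State.setReg, State.tick, r5]
    · simp [State.setReg, State.tick, Multigraph.weight_singleton]
    · simp only [State.setReg, State.tick, Expr.eval, Function.update_apply, Nat.reduceEqDiff,
        if_true, if_false, r2, r4, e9, e10, e11]
      exact a11
    · simp only [State.setReg, State.tick, Expr.eval, Function.update_apply, Nat.reduceEqDiff,
        if_true, if_false, r4, r5, e12, e13, e14]
      exact a9
    · intro x _; exact hmem 1 x
    · simp [State.setReg, State.tick, r9]
    · simp [State.setReg, State.tick, r0]
    · simp [State.setReg, State.tick, r9]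
    · simp [State.setReg, State.tick, hclock, Expr.cost, Test.cost]

end RAM

namespace Multigraph
variable {n : ℕ} (G : Multigraph n)

lemma le_totalDeg (hd : ∀ v, 0 < G.deg v) : n ≤ G.totalDeg := by
  have : ∑ _v : Fin n, 1 ≤ G.totalDeg := Finset.sum_le_sum fun v _ => hd v
  simpa using this

/-- Without loops, a vertex of positive degree has a neighbour other than itself. This keeps `log n`
away from zero. -/
lemma two_le (hd : ∀ v, 0 < G.deg v) (i : Fin n) : 2 ≤ n := by
  by_contra h
  have hn : n = 1 := by have := i.2; omega
  subst hn
  obtain ⟨v, hv⟩ := List.exists_mem_of_length_pos (hd i)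
  exact G.loopless i (Subsingleton.elim v i ▸ hv)

/-- The number `N` of runs satisfies `lB ≤ Nw ≤ 2lB`. Hence `q ^ N ≤ exp (-αwN) ≤ exp (-l) ≤ 1/l`,
and the expected weight `N * l * w` is at most `2/l` of the budget. -/
lemma pow_add_div_le {q α : ℝ} {l B w : ℕ} (hq : 0 ≤ q) (hα : 0 < α) (hB : 1 / α ≤ B)
    (hl : 0 < l) (hw : 0 < w) (hwB : w ≤ B) (h : q ≤ 1 - α * w) :
    q ^ (l * B / w + 1) + (l * B / w + 1 : ℕ) * l * w / (l ^ 3 * B : ℕ) ≤ 3 / l := by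
  have hl' : (1 : ℝ) ≤ l := by exact_mod_cast hl
  have hB' : (0 : ℝ) < B := by exact_mod_cast hw.trans_le hwB
  have hN1 : (l * B : ℝ) ≤ w * (l * B / w + 1 : ℕ) := by
    exact_mod_cast (Nat.lt_mul_div_succ (l * B) hw).le
  have hN2 : ((l * B / w + 1 : ℕ) : ℝ) * w ≤ 2 * (l * B) := by
    have h1 : (l * B / w + 1) * w ≤ 2 * (l * B) := by
      have := Nat.div_mul_le_self (l * B) w
      have : w ≤ l * B := hwB.trans (Nat.le_mul_of_pos_left _ hl)
      rw [add_mul]; omega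
    exact_mod_cast h1
  set N := l * B / w + 1
  have h1 : q ^ N ≤ 1 / l := by
    have hexp : q ≤ Real.exp (-(α * w)) := by
      have := Real.add_one_le_exp (-(α * (w : ℝ))); linarith
    have h2 : q ^ N ≤ Real.exp (-(l : ℝ)) := by
      refine (pow_le_pow_left₀ hq hexp N).trans ?_
      rw [← Real.exp_nat_mul, Real.exp_le_exp]
      rw [div_le_iff₀ hα] at hB
      have : α * (l * B) ≤ α * (w * N) := mul_le_mul_of_nonneg_left hN1 hα.le
      nlinarith
    refine h2.trans ?_
    rw [Real.exp_neg, ← one_div]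
    exact one_div_le_one_div_of_le (by linarith) (by linarith [Real.add_one_le_exp (l : ℝ)])
  have h3 : (N : ℝ) * l * w / (l ^ 3 * B : ℕ) ≤ 2 / l := by
    push_cast
    rw [div_le_div_iff₀ (by positivity) (by linarith)]
    have : (N : ℝ) * w * l ^ 2 ≤ 2 * (l * B) * l ^ 2 := by gcongr
    nlinarith
  calc _ ≤ 1 / (l : ℝ) + 2 / l := add_le_add h1 h3
    _ = 3 / l := by ring

end Multigraph

/-! ### Guarantees of the whole program -/

namespace RAM
variable {n : ℕ} {G : Multigraph n} {φ : ℝ} {M l B : ℕ} {i : Fin n}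

theorem wp_cutOrBound (hd : ∀ v, 0 < G.deg v) (hl : 0 < l)
    (hB : 0 < B) (hBm : B ≤ G.totalDeg) (hM : 16 * l ^ 3 * G.totalDeg ^ 3 < M) :
    wp G φ M cutOrBound (fun v => v.clock ≤ 600 * l ^ 4 * B ∧ (v.reg 0 = 0 ∨
      ∃ S : Finset (Fin n), OutputsSet v S ∧ S.Nonempty ∧ Sᶜ.Nonempty ∧ G.conductance S < φ))
      (initState M n G.totalDeg i l B) := by
  have hn := G.le_totalDeg hd
  have hP := Setup.of_lt hd hn hl hB hBm hM
  have hlB : 0 < l ^ 4 * B := by positivity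
  rcases exec_cutOrBound (φ := φ) (i := i) hd hn hl hB hBm hM with
    ⟨-, t, h1, h2, h3⟩ | ⟨hw, t, h1, h2, h3, h4⟩
  · intro v hv
    rw [h3, PMF.support_pure, Set.mem_singleton_iff] at hv
    subst hv
    exact ⟨by rw [mul_assoc]; omega, Or.inl h1⟩
  · intro v hv
    rw [h4] at hv
    have b1 : l ^ 3 * B ≤ l ^ 4 * B :=
      Nat.mul_le_mul_right _ (Nat.pow_le_pow_right hl (by norm_num))
    have b5 : 0 < l * B := by positivity
    have b2 : l * B + 1 ≤ 2 * (l * B) := by omega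
    have b3 : B ≤ l ^ 4 * B := Nat.le_mul_of_pos_left _ (by positivity)
    have b4 : l * B ≤ G.totalDeg ^ 3 * l ^ 3 := by
      rw [mul_comm]
      exact Nat.mul_le_mul (hBm.trans (Nat.le_self_pow (by norm_num) _))
        (Nat.le_self_pow (by norm_num) l)
    obtain ⟨hI, hc⟩ := wp_mainLoop hP h1 (by
      have : 16 * l ^ 3 * G.totalDeg ^ 3 = 16 * (G.totalDeg ^ 3 * l ^ 3) := by ring
      omega) v hv
    constructor
    · have b6 : (l * B / G.weight {i} + 1) * (21 + 101 * l) ≤ 244 * (l ^ 4 * B) := by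
        calc (l * B / G.weight {i} + 1) * (21 + 101 * l) ≤ (2 * (l * B)) * (122 * l) := by
              gcongr
              · exact (Nat.add_le_add_right (Nat.div_le_self _ _) 1).trans b2
              · omega
          _ = 244 * (l ^ 2 * B) := by ring
          _ ≤ _ := by gcongr 244 * (?_ * B); exact Nat.pow_le_pow_right hl (by norm_num)
      rw [mul_assoc]
      omega
    · rcases Nat.eq_zero_or_pos (v.reg 0) with h0 | h0
      · exact Or.inl h0
      · obtain ⟨S, hS, hw', hcut⟩ := hI.out h0
        have hne := hS.pos_iff.1 h0
        exact Or.inr ⟨S, ⟨h0, hS.lt, hS.mem⟩, hne,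
          G.conductance_lt hne hd (hw'.trans hBm) hcut⟩

theorem expect_cutOrBound_le {α : ℝ} (hd : ∀ v, 0 < G.deg v) (hl : 0 < l) (hα : 0 < α)
    (hB : 1 / α ≤ B) (hBm : B ≤ G.totalDeg) (hM : 16 * l ^ 3 * G.totalDeg ^ 3 < M)
    (h0 : 0 ≤ φ) (hdec : Multigraph.decay φ ^ l ≤ α) {j : Fin n}
    (hj : 256 * α < G.walkProb i l j / (2 * G.deg j)) :
    expect (cutOrBound.exec G φ M (initState M n G.totalDeg i l B))
      (fun v => if v.reg 0 = 0 then 1 else 0) ≤ ENNReal.ofReal (3 / l) := by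
  have hn := G.le_totalDeg hd
  have hB0 : (0 : ℝ) < B := lt_of_lt_of_le (by positivity) hB
  have hB' : 0 < B := by exact_mod_cast hB0
  have hP := Setup.of_lt hd hn hl hB' hBm hM
  have hw0 : 0 < G.weight {i} := by
    rw [Multigraph.weight_singleton]; have := hd i; omega
  rcases exec_cutOrBound (φ := φ) (i := i) hd hn hl hB' hBm hM with
    ⟨hw, -⟩ | ⟨hw, t, h1, h2, h3, h4⟩
  -- On an immediate declaration the bound `1 / w ≤ 1 / B ≤ α` contradicts `hj`.
  · exfalso
    have k1 := G.walkProb_div_le hd i j l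
    have k2 : 1 / (G.weight {i} : ℝ) ≤ 1 / B :=
      one_div_le_one_div_of_le hB0 (by exact_mod_cast hw.le)
    have k3 : 1 / (B : ℝ) ≤ α := by
      rw [div_le_iff₀ hB0]; rw [div_le_iff₀ hα] at hB; linarith
    linarith
  · rw [h4]
    have b4 : l * B ≤ G.totalDeg ^ 3 * l ^ 3 := by
      rw [mul_comm]
      exact Nat.mul_le_mul (hBm.trans (Nat.le_self_pow (by norm_num) _))
        (Nat.le_self_pow (by norm_num) l)
    have b5 : 0 < l * B := by positivity
    refine (expect_mainLoop_le hP rfl h1 (by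
      have : 16 * l ^ 3 * G.totalDeg ^ 3 = 16 * (G.totalDeg ^ 3 * l ^ 3) := by ring
      omega) h2).trans (ENNReal.ofReal_le_ofReal ?_)
    exact Multigraph.pow_add_div_le (G.failProb_nonneg _ _ _ _ _) hα hB hl hw0 hw
      (G.failProb_le hd hl h0 hα hB hdec hj)

/-- Markov's inequality for the complement of `A`. -/
lemma le_toOuterMeasure_of_expect (p : PMF State) {A : Set State} {f : State → ℝ≥0∞} {e : ℝ}
    (he : 0 ≤ e) (hf : ∀ s ∈ p.support, s ∉ A → 1 ≤ f s) (h : expect p f ≤ ENNReal.ofReal e) :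
    ENNReal.ofReal (1 - e) ≤ p.toOuterMeasure A := by
  rw [ENNReal.ofReal_sub _ he, ENNReal.ofReal_one, tsub_le_iff_right]
  refine le_trans ?_ (add_le_add_right h _)
  rw [PMF.toOuterMeasure_apply, expect, ← ENNReal.tsum_add, ← p.tsum_coe]
  refine ENNReal.tsum_le_tsum fun s => ?_
  by_cases hA : s ∈ A
  · rw [Set.indicator_of_mem hA]
    exact le_self_add
  · rw [Set.indicator_of_notMem hA, zero_add]
    by_cases hs : p s = 0
    · rw [hs]; exact zero_le
    · exact le_mul_of_one_le_right' (hf s hs hA)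

end RAM

/-! ### Word length and the final estimates -/

lemma exists_wordLength (L : ℕ) : ∃ c : ℕ, ∀ l m : ℕ, l ≤ L * m →
    16 * l ^ 3 * m ^ 3 < 2 ^ (c * Nat.size m) ∨ m = 0 := by
  -- The product is at most `16 L³ m⁶`; six word-sized factors cover `m⁶`, and `16 L³ < 2 ^ (16 L³)`
  -- covers the constant.
  refine ⟨6 + 16 * L ^ 3, fun l m h => ?_⟩
  rcases Nat.eq_zero_or_pos m with hm | hm
  · exact Or.inr hm
  left
  have h1 : m < 2 ^ Nat.size m := Nat.lt_size_self m
  have h2 : 1 ≤ Nat.size m := Nat.size_pos.2 hm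
  calc 16 * l ^ 3 * m ^ 3 ≤ 16 * (L * m) ^ 3 * m ^ 3 := by gcongr
    _ = m ^ 6 * (16 * L ^ 3) := by ring
    _ < (2 ^ Nat.size m) ^ 6 * 2 ^ (16 * L ^ 3) := by
        refine Nat.mul_lt_mul_of_lt_of_lt (Nat.pow_lt_pow_left h1 (by norm_num)) Nat.lt_two_pow_self
    _ ≤ (2 ^ Nat.size m) ^ 6 * 2 ^ (16 * L ^ 3 * Nat.size m) := by
        exact Nat.mul_le_mul_left _
          (Nat.pow_le_pow_right (by norm_num) (Nat.le_mul_of_pos_right _ h2))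
    _ = _ := by rw [← pow_mul, ← pow_add]; ring_nf

theorem mainTheorem2 :
    ∃ P : RAM.Cmd, ∀ (ζ τ φ : ℝ) (K : ℕ), 0 < ζ → τ < 1 → ζ * τ < 1 / 8 →
      0 ≤ φ → φ ≤ 1 / 2 →
      -Real.log (1 / 2 * (Real.sqrt (1 - 2 * φ) + Real.sqrt (1 + 2 * φ))) = ζ * τ →
      ∃ (c : ℕ) (C : ℝ) (err : ℕ → ℝ), Filter.Tendsto err Filter.atTop (nhds 0) ∧
        ∀ (n : ℕ) (G : Multigraph n) (i : Fin n) (α : ℝ) (ℓ : ℕ),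
          (∀ v, 0 < G.deg v) → G.totalDeg ≤ n ^ K →
          α = (G.totalDeg : ℝ) ^ (-τ) → ℓ = ⌈Real.log G.totalDeg / ζ⌉₊ →
          (∀ s ∈ (runProgram P c G i ℓ α φ).support,
            (s.clock : ℝ) ≤ C * Real.log n ^ 4 / α) ∧
          ENNReal.ofReal (1 - err n) ≤
            (runProgram P c G i ℓ α φ).toOuterMeasure {s | CorrectAnswer G i ℓ α φ s} := by
  refine ⟨RAM.cutOrBound, fun ζ τ φ K hζ hτ _ h0 h1 hφ => ?_⟩
  obtain ⟨c, hc⟩ := exists_wordLength ⌈1 / ζ + 1⌉₊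
  -- The clock is at most `600 ℓ⁴ ⌈1/α⌉` with `⌈1/α⌉ ≤ 2/α`, and `ℓ ≤ log m / ζ + 1` with `log m ≤ K
  -- log n` and `1 ≤ log n / log 2`. The error is `3/ℓ`, where `ℓ ≥ log n / ζ`.
  refine ⟨c, 1200 * (K / ζ + 1 / Real.log 2) ^ 4, fun n => 3 * ζ / Real.log n,
    (Real.tendsto_log_atTop.comp tendsto_natCast_atTop_atTop).const_div_atTop _,
    fun n G i α l hd hK hα hl => ?_⟩
  have hn2 := G.two_le hd i
  have hnm := G.le_totalDeg hd
  set m := G.totalDeg with hm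
  have hlog2 : 0 < Real.log 2 := Real.log_pos (by norm_num)
  have hn2' : (2 : ℝ) ≤ n := by exact_mod_cast hn2
  have hnm' : (n : ℝ) ≤ m := by exact_mod_cast hnm
  have hm1 : (1 : ℝ) ≤ m := by linarith
  have hlogn : Real.log 2 ≤ Real.log n := Real.log_le_log (by norm_num) hn2'
  have hlognm : Real.log n ≤ Real.log m := Real.log_le_log (by linarith) hnm'
  have hle : Real.log m / ζ ≤ l := hl ▸ Nat.le_ceil _
  have hlt : (l : ℝ) < Real.log m / ζ + 1 :=
    hl ▸ Nat.ceil_lt_add_one (div_nonneg (by linarith) hζ.le)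
  obtain ⟨hτ0, hdec⟩ := Multigraph.decay_pow_le hζ h0 h1 hφ (by linarith : (0 : ℝ) < m) hle
  rw [← hα] at hdec
  have hα0 : 0 < α := hα ▸ Real.rpow_pos_of_pos (by linarith) _
  have hα1 : α ≤ 1 := hα ▸ Real.rpow_le_one_of_one_le_of_nonpos hm1 (by linarith)
  have hinv : 1 / α = (m : ℝ) ^ τ := by rw [hα, Real.rpow_neg (by linarith), one_div, inv_inv]
  have hB : 1 / α ≤ (⌈1 / α⌉₊ : ℝ) := Nat.le_ceil _
  have hB1 : 1 ≤ 1 / α := by rwa [one_le_div hα0]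
  -- This is where `τ < 1` enters: sets of weight at most `⌈1/α⌉` have at most half the total
  -- weight.
  have hBm : ⌈1 / α⌉₊ ≤ m := by
    rw [Nat.ceil_le, hinv]
    simpa using Real.rpow_le_rpow_of_exponent_le hm1 hτ.le
  have hB0 : 0 < ⌈1 / α⌉₊ := Nat.ceil_pos.2 (by linarith)
  have hl0' : (0 : ℝ) < l := lt_of_lt_of_le (div_pos (by linarith) hζ) hle
  have hl0 : 0 < l := by exact_mod_cast hl0'
  have hlm : l ≤ ⌈1 / ζ + 1⌉₊ * m := by
    have k1 : Real.log m ≤ m := (Real.log_le_sub_one_of_pos (by linarith)).trans (by linarith)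
    have k2 : (l : ℝ) ≤ (1 / ζ + 1) * m := by
      have : Real.log m / ζ ≤ 1 / ζ * m := by
        rw [div_mul_eq_mul_div, one_mul]; gcongr
      nlinarith
    have k3 : (1 / ζ + 1) * (m : ℝ) ≤ ⌈1 / ζ + 1⌉₊ * m :=
      mul_le_mul_of_nonneg_right (Nat.le_ceil _) (by linarith)
    exact_mod_cast k2.trans k3
  have hM : 16 * l ^ 3 * m ^ 3 < 2 ^ (c * Nat.size m) := (hc l m hlm).resolve_right (by omega)
  have hwp := RAM.wp_cutOrBound (φ := φ) (i := i) hd hl0 hB0 hBm hM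
  constructor
  · intro s hs
    have hclock : (s.clock : ℝ) ≤ 600 * (l : ℝ) ^ 4 * (⌈1 / α⌉₊ : ℝ) := by
      exact_mod_cast (hwp s hs).1
    have k1 : (⌈1 / α⌉₊ : ℝ) ≤ 2 * (1 / α) := by
      have := Nat.ceil_lt_add_one (show 0 ≤ 1 / α by linarith)
      linarith
    have k2 : (l : ℝ) ≤ (K / ζ + 1 / Real.log 2) * Real.log n := by
      have q1 : Real.log m ≤ K * Real.log n := by
        rw [← Real.log_pow]
        exact Real.log_le_log (by linarith) (by exact_mod_cast hK)
      have q2 : 1 ≤ 1 / Real.log 2 * Real.log n := by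
        rw [div_mul_eq_mul_div, one_mul, one_le_div hlog2]; exact hlogn
      have q3 : Real.log m / ζ ≤ K / ζ * Real.log n := by
        rw [div_mul_eq_mul_div]; gcongr
      rw [add_mul]
      linarith
    calc (s.clock : ℝ) ≤ 600 * (l : ℝ) ^ 4 * (⌈1 / α⌉₊ : ℝ) := hclock
      _ ≤ 600 * ((K / ζ + 1 / Real.log 2) * Real.log n) ^ 4 * (2 * (1 / α)) := by gcongr
      _ = _ := by ring
  -- If the bound holds, every possible answer is correct; otherwise only the declaration is wrong.
  · by_cases hmix : ∀ j, G.walkProb i l j / (2 * G.deg j) ≤ 256 * α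
    · refine RAM.le_toOuterMeasure_of_expect _ (f := fun _ => 0)
        (div_nonneg (by positivity) (by linarith)) (fun s hs hA => ?_) ?_
      · exfalso
        rcases (hwp s hs).2 with h | h
        · exact hA (Or.inr ⟨h, hmix⟩)
        · exact hA (Or.inl h)
      · simp [RAM.expect]
    · push Not at hmix
      obtain ⟨j, hj⟩ := hmix
      refine RAM.le_toOuterMeasure_of_expect _ (f := fun v => if v.reg 0 = 0 then 1 else 0)
        (div_nonneg (by positivity) (by linarith)) (fun s hs hA => ?_) ?_
      · rcases (hwp s hs).2 with h | h
        · rw [if_pos h]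
        · exact absurd (Or.inl h) hA
      · refine (RAM.expect_cutOrBound_le hd hl0 hα0 hB hBm hM h0 hdec hj).trans
          (ENNReal.ofReal_le_ofReal ?_)
        rw [div_le_div_iff₀ hl0' (by linarith)]
        rw [div_le_iff₀ hζ] at hle
        nlinarith
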